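/- Let $\overline{\mathbb R}=\mathbb R\cup\{\pm\infty\}$ with the usual order, and extend subtraction by $\gamma-\infty=-\infty$ and $-\infty-\beta=-\infty$ for all $\beta,\gamma\in\overline{\mathbb R}$, $\infty-\beta=\infty$ for $\beta<\infty$, and $u-(-\infty)=\infty$ for $u\in\mathbb R$. A $k$-ary $\overline{\mathbb R}$-valued relation on a set $D$ is a function $\rho\colon D^k\to\overline{\mathbb R}$; for $\alpha<\infty$ its sublevel set is $\rho^\alpha=\{\mathbf d\in D^k\mid \rho(\mathbf d)\le\alpha\}$. Let $D$ be a finite set and $\mathcal D$ a finite set of $\overline{\mathbb R}$-valued relations (of arbitrary finite arities) on $D$ taking values in $\mathbb Q\cup\{\pm\infty\}$, and let $U\mathcal D=\{\rho^\alpha\mid\rho\in\mathcal D,\ \alpha<\infty\}$. $\mathrm{TVCSP}(\mathcal D)$ is the following problem. An instance $I=(V,D,\mathcal C)$ consists of a finite set $V$ and a finite set $\mathcal C$ of triples $(k,\sigma,\rho)$ with $k\in\mathbb N$, $\sigma\colon V^k\to\mathbb Q\cup\{\pm\infty\}$, and $\rho\in\mathcal D$ of arity $k$. The task is to compute $$\mathcal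 O(I)=\inf_{s\colon V\to D}\ \sup_{(k,\sigma,\rho)\in\mathcal C}\ \sup_{\mathbf x\in V^k}\bigl(\rho(s(\mathbf x))-\sigma(\mathbf x)\bigr).$$ Here $\sigma$ and $\rho$ are given by the lists of all pairs $(\mathbf x,\sigma(\mathbf x))$ with $\sigma(\mathbf x)<\infty$ and of all pairs $(\mathbf d,\rho(\mathbf d))$ with $\rho(\mathbf d)<\infty$, rational numbers being written as fractions in binary. $\mathrm{CSP}(U\mathcal D)$ is the following problem. An instance $(V,D,\mathcal C)$ consists of a finite set $V$ and a finite set $\mathcal C$ of triples $(k,\mathbf x,\rho)$ with $k\in\mathbb N$, $\mathbf x\in V^k$ and $\rho\in U\mathcal D$ of arity $k$ (given by the list of its elements). The task is to decide whether there is an $s\colon V\to D$ with $s(\mathbf x)\in\rho$ for all $(k,\mathbf x,\rho)\in\mathcal C$. Then $\mathrm{TVCSP}(\mathcal D)$ and $\mathrm{CSP}(U\mathcal D)$ are polynomial-time (Turing) reducible to each other: each of the two problems can be solved in polynomial time with an oracle for the other. -/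

import Mathlib

namespace TropicalCSP

/-! ### Data, programs with an oracle, and their running time -/

/-- The data on which programs operate: binary trees, that is, nested lists. -/
inductive Data
  | nil : Data
  | cons : Data → Data → Data

namespace Data

/-- The number of nodes of a tree; this is the length of an input. -/
def size : Data → ℕ
  | nil => 1
  | cons a b => size a + size b + 1

/-- First component (`nil` for `nil`). -/
def head : Data → Data
  | nil => nil
  | cons a _ => a

/-- Second component (`nil` for `nil`). -/
def tail : Data → Data
  | nil => nil
  | cons _ b => b

/-- A list of trees as a tree. -/
def ofList : List Data → Data
  | [] => nil
  | a :: l => cons a (ofList l)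

/-- A truth value as a tree. -/
def ofBool : Bool → Data
  | false => nil
  | true => cons nil nil

/-- A natural number in binary, least significant digit first, without leading zeros. -/
def ofNat (n : ℕ) : Data := ofList (n.bits.map ofBool)

/-- A natural number in unary. -/
def unary (n : ℕ) : Data := ofList (List.replicate n nil)

end Data

/-- Deterministic programs of a while language on trees, with a primitive that queries an oracle.
Every program transforms one tree into one tree. -/
inductive Prog
  | nil : Prog
  | id : Prog
  | head : Prog
  | tail : Prog
  | cons : Prog → Prog → Prog
  | comp : Prog → Prog → Prog
  | cond : Prog → Prog → Prog → Prog
  | loop : Prog → Prog → Prog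
  | query : Prog

/-- `Eval O p x y t`: with the oracle `O`, the program `p` halts on the input `x` with the output
`y` in time `t`. The tree `nil` counts as false and every other tree as true.
Every primitive costs one unit of time. In addition, building a tree costs its size, and a query
costs the size of the queried tree. So within time `t` a program can only build trees of size at
most `t`; up to polynomial overhead, time is that of an oracle Turing machine (for oracles with
answers of polynomial length). -/
inductive Eval (O : Data → Data) : Prog → Data → Data → ℕ → Prop
  | nil (x : Data) : Eval O Prog.nil x Data.nil 1
  | id (x : Data) : Eval O Prog.id x x 1
  | head (x : Data) : Eval O Prog.head x x.head 1
  | tail (x : Data) : Eval O Prog.tail x x.tail 1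
  | cons {f g : Prog} {x y z : Data} {t u : ℕ} :
      Eval O f x y t → Eval O g x z u →
      Eval O (Prog.cons f g) x (Data.cons y z) (t + u + (Data.cons y z).size + 1)
  /-- first `f`, then `g` -/
  | comp {f g : Prog} {x y z : Data} {t u : ℕ} :
      Eval O f x y t → Eval O g y z u → Eval O (Prog.comp g f) x z (t + u + 1)
  /-- if `c` then `f` else `g` -/
  | cond_true {c f g : Prog} {x b y : Data} {t u : ℕ} :
      Eval O c x b t → b ≠ Data.nil → Eval O f x y u →
      Eval O (Prog.cond c f g) x y (t + u + 1)
  | cond_false {c f g : Prog} {x y : Data} {t u : ℕ} :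
      Eval O c x Data.nil t → Eval O g x y u →
      Eval O (Prog.cond c f g) x y (t + u + 1)
  /-- while `c` do `f` -/
  | loop_stop {c f : Prog} {x : Data} {t : ℕ} :
      Eval O c x Data.nil t → Eval O (Prog.loop c f) x x (t + 1)
  | loop_step {c f : Prog} {x b y z : Data} {t u v : ℕ} :
      Eval O c x b t → b ≠ Data.nil → Eval O f x y u → Eval O (Prog.loop c f) y z v →
      Eval O (Prog.loop c f) x z (t + u + v + 1)
  | query (x : Data) : Eval O Prog.query x (O x) (x.size + 1)

/-! ### Computational problems and polynomial-time reducibility -/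

/-- A computational problem: its instances, the trees that represent an instance, and the trees
that are correct answers to an instance. A decision problem has the answers `Data.ofBool b`. -/
structure Problem where
  Inst : Type*
  Code : Inst → Data → Prop
  Answer : Inst → Data → Prop

/-- The oracle `O` solves `B`: on every representation of every instance of `B` it gives a correct
answer (nothing is known about it on other trees). -/
def Solves (O : Data → Data) (B : Problem) : Prop :=
  ∀ (I : B.Inst) (w : Data), B.Code I w → B.Answer I (O w)

/-- Polynomial-time (Turing) reducibility of `A` to `B`: one program, in time bounded by one
polynomial in the length of the input, solves `A` with the help of any oracle that solves `B`. -/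
def PolyTimeReducible (A B : Problem) : Prop :=
  ∃ (P : Prog) (p : Polynomial ℕ), ∀ O : Data → Data, Solves O B →
    ∀ (I : A.Inst) (w : Data), A.Code I w →
      ∃ (y : Data) (t : ℕ), Eval O P w y t ∧ A.Answer I y ∧ t ≤ p.eval w.size

/-! ### Representations -/

/-- `v` is an element of `ℚ ∪ {±∞}`. -/
def IsExtRat (v : EReal) : Prop :=
  v = ⊥ ∨ v = ⊤ ∨ ∃ q : ℚ, v = ((q : ℝ) : EReal)

/-- Representations of the elements of `ℚ ∪ {±∞}`; a rational number is given by the sign and the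
absolute value of the numerator and by the denominator of a fraction, the numbers in binary. -/
inductive CodesExtRat : EReal → Data → Prop
  | bot : CodesExtRat ⊥ (Data.ofList [])
  | top : CodesExtRat ⊤ (Data.ofList [Data.nil])
  | rat (p : ℤ) (q : ℕ) (hq : 0 < q) :
      CodesExtRat (((p : ℝ) / (q : ℝ) : ℝ) : EReal)
        (Data.ofList [Data.ofBool (decide (p < 0)), Data.ofNat p.natAbs, Data.ofNat q])

/-- A `k`-tuple of elements that are numbered by `e`. -/
def codeTuple {A : Type*} (e : A → ℕ) {k : ℕ} (x : Fin k → A) : Data :=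
  Data.ofList (List.ofFn fun i => Data.ofNat (e (x i)))

/-- `w` is a list of representations (in the sense of `R`) of all elements of `S` and of nothing
else, in any order. -/
def CodesSet {A : Type*} (R : A → Data → Prop) (S : Set A) (w : Data) : Prop :=
  ∃ l : List Data, w = Data.ofList l ∧
    (∀ a ∈ S, ∃ c ∈ l, R a c) ∧ (∀ c ∈ l, ∃ a ∈ S, R a c)

/-- `w` is a list of all pairs `(x, f x)` with `f x < ∞`. -/
def CodesValuedRel {A : Type*} (e : A → ℕ) {k : ℕ} (f : (Fin k → A) → EReal) (w : Data) : Prop :=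
  CodesSet (fun x c => ∃ v : Data, CodesExtRat (f x) v ∧ c = Data.cons (codeTuple e x) v)
    {x | f x < ⊤} w

/-- `w` is a list of all elements of the relation `r`. -/
def CodesRel {A : Type*} (e : A → ℕ) {k : ℕ} (r : Set (Fin k → A)) (w : Data) : Prop :=
  CodesSet (fun x c => c = codeTuple e x) r w

/-! ### The tropical valued CSP -/

/-- An extended-real-valued constraint `(k, σ, ρ)`. -/
structure TVConstraint (V D : Type*) where
  arity : ℕ
  σ : (Fin arity → V) → EReal
  ρ : (Fin arity → D) → EReal

/-- A TVCSP instance with domain `D`; its variables are `0, …, numVars - 1`. -/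
structure TVCSPInstance (D : Type*) where
  numVars : ℕ
  constraints : Set (TVConstraint (Fin numVars) D)
  finite_constraints : constraints.Finite

namespace TVCSPInstance

variable {D : Type*}

/-- The value `𝒮(I)(s)` of an assignment. The subtraction of `EReal` has
`∞ - ∞ = (-∞) - (-∞) = -∞`, as required. -/
noncomputable def value (I : TVCSPInstance D) (s : Fin I.numVars → D) : EReal :=
  ⨆ c ∈ I.constraints, ⨆ x : Fin c.arity → Fin I.numVars, (c.ρ (s ∘ x) - c.σ x)

/-- The optimal value `𝒪(I)`. -/
noncomputable def opt (I : TVCSPInstance D) : EReal :=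
  ⨅ s : Fin I.numVars → D, I.value s

/-- `w` represents `I`, the elements of `D` being numbered by `e`. An instance has a
representation only if all `σ` and `ρ` in it take values in `ℚ ∪ {±∞}`. -/
def Codes {m : ℕ} (e : D ≃ Fin m) (I : TVCSPInstance D) (w : Data) : Prop :=
  ∃ l : Data,
    CodesSet (fun (c : TVConstraint (Fin I.numVars) D) u => ∃ a b : Data,
        CodesValuedRel Fin.val c.σ a ∧ CodesValuedRel (fun d => (e d : ℕ)) c.ρ b ∧
          u = Data.ofList [Data.ofNat c.arity, a, b])
      I.constraints l ∧
    w = Data.ofList [Data.unary I.numVars, Data.unary m, l]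

end TVCSPInstance

/-- The problem `TVCSP(𝒟)`: compute `𝒪(I)` for the instances `I` all of whose constraints
`(k, σ, ρ)` have `ρ ∈ 𝒟`. -/
def TVCSP {D : Type*} {m : ℕ} (e : D ≃ Fin m) (𝒟 : Set (Σ k : ℕ, ((Fin k → D) → EReal))) :
    Problem where
  Inst := {I : TVCSPInstance D // ∀ c ∈ I.constraints, ⟨c.arity, c.ρ⟩ ∈ 𝒟}
  Code I w := I.1.Codes e w
  Answer I y := CodesExtRat I.1.opt y

/-! ### The CSP -/

/-- A constraint `(k, 𝐱, ρ)`. -/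
structure CSPConstraint (V D : Type*) where
  arity : ℕ
  scope : Fin arity → V
  rel : Set (Fin arity → D)

/-- A CSP instance with domain `D`; its variables are `0, …, numVars - 1`. -/
structure CSPInstance (D : Type*) where
  numVars : ℕ
  constraints : Set (CSPConstraint (Fin numVars) D)
  finite_constraints : constraints.Finite

namespace CSPInstance

variable {D : Type*}

/-- The set `𝒮(I)` of solutions. -/
def solutions (I : CSPInstance D) : Set (Fin I.numVars → D) :=
  {s | ∀ c ∈ I.constraints, s ∘ c.scope ∈ c.rel}

/-- `w` represents `I`, the elements of `D` being numbered by `e`. -/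
def Codes {m : ℕ} (e : D ≃ Fin m) (I : CSPInstance D) (w : Data) : Prop :=
  ∃ l : Data,
    CodesSet (fun (c : CSPConstraint (Fin I.numVars) D) u => ∃ b : Data,
        CodesRel (fun d => (e d : ℕ)) c.rel b ∧
          u = Data.ofList [Data.ofNat c.arity, codeTuple Fin.val c.scope, b])
      I.constraints l ∧
    w = Data.ofList [Data.unary I.numVars, Data.unary m, l]

end CSPInstance

open Classical in
/-- The problem `CSP(ℛ)`: decide whether `𝒮(I)` is nonempty, for the instances `I` all of whose
constraints `(k, 𝐱, ρ)` have `ρ ∈ ℛ`. -/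
def CSP {D : Type*} {m : ℕ} (e : D ≃ Fin m) (ℛ : Set (Σ k : ℕ, Set (Fin k → D))) :
    Problem where
  Inst := {I : CSPInstance D // ∀ c ∈ I.constraints, ⟨c.arity, c.rel⟩ ∈ ℛ}
  Code I w := I.1.Codes e w
  Answer I y := y = Data.ofBool (decide I.1.solutions.Nonempty)

/-- The sublevel set `ρ^α`. -/
def sublevel {D : Type*} {k : ℕ} (ρ : (Fin k → D) → EReal) (α : EReal) : Set (Fin k → D) :=
  {d | ρ d ≤ α}

/-- The set `U𝒟` of all sublevel sets `ρ^α` with `ρ ∈ 𝒟` and `α < ∞`. -/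
def U {D : Type*} (𝒟 : Set (Σ k : ℕ, ((Fin k → D) → EReal))) :
    Set (Σ k : ℕ, Set (Fin k → D)) :=
  {r | ∃ ρ ∈ 𝒟, ∃ α : EReal, α < ⊤ ∧ r = ⟨ρ.1, sublevel ρ.2 α⟩}

end TropicalCSP

namespace TropicalCSP

/-! ### Trees as lists -/

namespace Data

/-! For a threshold `γ < ⊤`, `𝒪(I) ≤ γ` holds iff some assignment `s` satisfies `ρ(s(x)) - σ(x) ≤ γ`
for every constraint and every `x`. When `σ(x) < ⊤` this says that `s(x)` lies in the sublevel set
of `ρ` at `γ + σ(x) < ⊤` (`EReal_sub_le_iff`); when `σ(x) = ⊤` it says nothing. So a threshold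
question is one CSP instance over `U 𝒟`, and both reductions rest on this.

From TVCSP to CSP: infimum and supremum run over finite sets, so the optimum is `⊥`, `⊤`, or a
difference `ρ(d) - σ(x)` of two rational entries listed in the input
(`TVCSPInstance.exists_mem_candidates`). There are polynomially many such differences. Querying the
threshold `⊥` and every candidate, and keeping the least candidate that passes, yields the optimum
(`TVCSPInstance.codesExtRat_optimum`); no binary search is involved.

From CSP to TVCSP: `U 𝒟` is finite, and each of its relations is a sublevel set `ρ^α` whose level
`α` is `⊥` or rational (`exists_extRat_of_mem_U`). A constraint on the scope `x` becomes the valued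
constraint with `σ = α` at `x` and `σ = ⊤` elsewhere. The CSP instance is solvable iff the optimum
of the new instance is at most `0`, which one query decides. A finite table of `U 𝒟` with the chosen
`ρ` and `α` is built into the program.

The rest shows that these procedures run in polynomial time in the given machine model. The class
`PolyTime` is closed under composition, case distinction and folds over lists with polynomially
bounded accumulators. It records output size besides time, because time alone does not bound the
size of an output that reuses parts of the input. An oracle answer has no size bound, so it is only
inspected by tests of constant time (`PolyTime.test_query`). School arithmetic on binary digits
gives difference and comparison of fractions. -/

/-- The list of trees that a tree represents. -/
def toList : Data → List Data
  | nil => []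
  | cons a b => a :: toList b

@[simp] theorem head_cons (a b : Data) : (cons a b).head = a := rfl
@[simp] theorem tail_cons (a b : Data) : (cons a b).tail = b := rfl
@[simp] theorem head_nil : nil.head = nil := rfl
@[simp] theorem tail_nil : nil.tail = nil := rfl
@[simp] theorem ofList_nil : ofList [] = nil := rfl
@[simp] theorem ofList_cons (a : Data) (l : List Data) : ofList (a :: l) = cons a (ofList l) := rfl
@[simp] theorem toList_nil : toList nil = [] := rfl
@[simp] theorem toList_cons (a b : Data) : toList (cons a b) = a :: toList b := rfl
@[simp] theorem size_nil : size nil = 1 := rfl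
@[simp] theorem size_cons (a b : Data) : size (cons a b) = size a + size b + 1 := rfl
@[simp] theorem ofBool_true : ofBool true = cons nil nil := rfl
@[simp] theorem ofBool_false : ofBool false = nil := rfl

@[simp] theorem toList_ofList (l : List Data) : toList (ofList l) = l := by
  induction l <;> simp_all

@[simp] theorem ofList_toList (d : Data) : ofList (toList d) = d := by
  induction d <;> simp_all

/-- The truth value of a tree in conditions. -/
def truthy : Data → Bool
  | nil => false
  | cons _ _ => true

@[simp] theorem truthy_nil : truthy nil = false := rfl
@[simp] theorem truthy_cons (a b : Data) : truthy (cons a b) = true := rfl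
@[simp] theorem truthy_ofBool (b : Bool) : truthy (ofBool b) = b := by cases b <;> rfl

theorem truthy_eq_false {d : Data} : d.truthy = false ↔ d = nil := by cases d <;> simp

theorem truthy_eq_true {d : Data} : d.truthy = true ↔ d ≠ nil := by cases d <;> simp

theorem size_pos (d : Data) : 0 < d.size := by cases d <;> simp

theorem size_head_le (d : Data) : d.head.size ≤ d.size := by
  cases d <;> simp; omega

theorem size_tail_le (d : Data) : d.tail.size ≤ d.size := by
  cases d <;> simp; omega

theorem size_ofBool_le (b : Bool) : (ofBool b).size ≤ 3 := by cases b <;> simp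

theorem length_toList_le (d : Data) : d.toList.length ≤ d.size := by
  induction d <;> simp_all; omega

theorem size_le_of_mem {d a : Data} (h : a ∈ d.toList) : a.size ≤ d.size := by
  induction d with
  | nil => simp at h
  | cons b c _ ih =>
    rcases List.mem_cons.1 h with rfl | h
    · simp; omega
    · have := ih h
      simp; omega

theorem size_ofList_append (l l' : List Data) :
    (ofList (l ++ l')).size + 1 = (ofList l).size + (ofList l').size := by
  induction l with
  | nil => simp; omega
  | cons a l ih => simp; omega

theorem size_ofList_le_of_suffix {l l' : List Data} (h : l <:+ l') :
    (ofList l).size ≤ (ofList l').size := by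
  obtain ⟨k, rfl⟩ := h
  have := size_ofList_append k l
  have := size_pos (ofList k)
  omega

/-- Equality of trees. -/
def beq : Data → Data → Bool
  | nil, nil => true
  | cons a b, cons c d => beq a c && beq b d
  | _, _ => false

theorem beq_eq_true {c d : Data} : beq c d = true ↔ c = d := by
  induction c generalizing d with
  | nil => cases d <;> simp [beq]
  | cons a b iha ihb => cases d <;> simp [beq, iha, ihb]

/-- Concatenation of the lists `f a`, for `a` in the list `l`. -/
def flatMap (f : Data → Data) (l : Data) : Data := ofList (l.toList.flatMap fun a => (f a).toList)

theorem toList_flatMap (f : Data → Data) (l : Data) :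
    (flatMap f l).toList = l.toList.flatMap fun a => (f a).toList := by
  simp [flatMap]

theorem mem_flatMap {f : Data → Data} {l b : Data} :
    b ∈ (flatMap f l).toList ↔ ∃ a ∈ l.toList, b ∈ (f a).toList := by
  simp [flatMap]

end Data

open Data

/-- The coefficients are natural numbers, so every monomial is monotone. -/
theorem eval_mono (p : Polynomial ℕ) {m n : ℕ} (h : m ≤ n) : p.eval m ≤ p.eval n := by
  rw [Polynomial.eval_eq_sum, Polynomial.eval_eq_sum]
  exact Finset.sum_le_sum fun i _ => Nat.mul_le_mul_left _ (Nat.pow_le_pow_left h i)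

/-! ### Functions that are computable in polynomial time -/

/-- The function `f O` is computed, with the oracle `O`, in polynomial time, and its values have
polynomial size; program and polynomial do not depend on `O`. -/
def PolyTime (f : (Data → Data) → Data → Data) : Prop :=
  ∃ (P : Prog) (p : Polynomial ℕ), ∀ O x, ∃ t,
    Eval O P x (f O x) t ∧ t + (f O x).size ≤ p.eval x.size

namespace PolyTime

variable {f g h : (Data → Data) → Data → Data} {b c : (Data → Data) → Data → Bool}

theorem exists_size_le (hf : PolyTime f) :
    ∃ p : Polynomial ℕ, ∀ O x, (f O x).size ≤ p.eval x.size := by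
  obtain ⟨_, p, hp⟩ := hf
  refine ⟨p, fun O x => ?_⟩
  obtain ⟨t, _, h⟩ := hp O x
  omega

theorem id : PolyTime fun _ x => x :=
  ⟨Prog.id, 1 + Polynomial.X, fun _ x => ⟨1, Eval.id x, by simp⟩⟩

theorem comp (hf : PolyTime f) (hg : PolyTime g) : PolyTime fun O x => f O (g O x) := by
  obtain ⟨P, p, hp⟩ := hf
  obtain ⟨Q, q, hq⟩ := hg
  refine ⟨Prog.comp P Q, p.comp q + q + 1, fun O x => ?_⟩
  obtain ⟨t, ht, ht'⟩ := hq O x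
  obtain ⟨u, hu, hu'⟩ := hp O (g O x)
  refine ⟨_, Eval.comp ht hu, ?_⟩
  have := eval_mono p (show (g O x).size ≤ q.eval x.size by omega)
  simp
  omega

theorem cons (hf : PolyTime f) (hg : PolyTime g) : PolyTime fun O x => (f O x).cons (g O x) := by
  obtain ⟨P, p, hp⟩ := hf
  obtain ⟨Q, q, hq⟩ := hg
  refine ⟨Prog.cons P Q, 2 * p + 2 * q + 3, fun O x => ?_⟩
  obtain ⟨t, ht, ht'⟩ := hp O x
  obtain ⟨u, hu, hu'⟩ := hq O x
  refine ⟨_, Eval.cons ht hu, ?_⟩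
  simp
  omega

theorem head (hf : PolyTime f) : PolyTime fun O x => (f O x).head := by
  refine comp (f := fun _ x => x.head) ⟨Prog.head, 1 + Polynomial.X, fun O x => ?_⟩ hf
  exact ⟨1, Eval.head x, by simpa using size_head_le x⟩

theorem tail (hf : PolyTime f) : PolyTime fun O x => (f O x).tail := by
  refine comp (f := fun _ x => x.tail) ⟨Prog.tail, 1 + Polynomial.X, fun O x => ?_⟩ hf
  exact ⟨1, Eval.tail x, by simpa using size_tail_le x⟩

theorem const (d : Data) : PolyTime fun _ _ => d := by
  induction d with
  | nil => exact ⟨Prog.nil, 2, fun O x => ⟨1, Eval.nil x, by simp⟩⟩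
  | cons a b iha ihb => exact iha.cons ihb

theorem ite_truthy (hf : PolyTime f) (hg : PolyTime g) (hh : PolyTime h) :
    PolyTime fun O x => cond (f O x).truthy (g O x) (h O x) := by
  obtain ⟨P, p, hp⟩ := hf
  obtain ⟨Q, q, hq⟩ := hg
  obtain ⟨R, r, hr⟩ := hh
  refine ⟨Prog.cond P Q R, p + q + r + 1, fun O x => ?_⟩
  obtain ⟨t, ht, ht'⟩ := hp O x
  obtain ⟨u, hu, hu'⟩ := hq O x
  obtain ⟨v, hv, hv'⟩ := hr O x
  cases hx : (f O x).truthy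
  · rw [truthy_eq_false.1 hx] at ht
    refine ⟨t + v + 1, by simpa [hx] using Eval.cond_false ht hv, ?_⟩
    simp [hx]
    omega
  · refine ⟨t + u + 1, by simpa [hx] using Eval.cond_true ht (truthy_eq_true.1 hx) hu, ?_⟩
    simp [hx]
    omega

theorem truthy (hf : PolyTime f) : PolyTime fun O x => ofBool (f O x).truthy := by
  convert hf.ite_truthy (const (ofBool true)) (const (ofBool false)) using 3 with O x
  cases (f O x).truthy <;> rfl

theorem ite (hb : PolyTime fun O x => ofBool (b O x)) (hf : PolyTime f) (hg : PolyTime g) :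
    PolyTime fun O x => cond (b O x) (f O x) (g O x) := by
  simpa using hb.ite_truthy hf hg

theorem ite_bool {d : (Data → Data) → Data → Bool} (hb : PolyTime fun O x => ofBool (b O x))
    (hc : PolyTime fun O x => ofBool (c O x)) (hd : PolyTime fun O x => ofBool (d O x)) :
    PolyTime fun O x => ofBool (cond (b O x) (c O x) (d O x)) := by
  convert hb.ite hc hd using 3 with O x
  cases b O x <;> rfl

theorem not (hb : PolyTime fun O x => ofBool (b O x)) : PolyTime fun O x => ofBool (!b O x) := by
  convert hb.ite_bool (c := fun _ _ => false) (d := fun _ _ => true) (const _) (const _)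
    using 4 with O x
  cases b O x <;> rfl

theorem and (hb : PolyTime fun O x => ofBool (b O x)) (hc : PolyTime fun O x => ofBool (c O x)) :
    PolyTime fun O x => ofBool (b O x && c O x) := by
  convert hb.ite_bool hc (d := fun _ _ => false) (const _) using 4 with O x
  cases b O x <;> rfl

theorem or (hb : PolyTime fun O x => ofBool (b O x)) (hc : PolyTime fun O x => ofBool (c O x)) :
    PolyTime fun O x => ofBool (b O x || c O x) := by
  convert hb.ite_bool (c := fun _ _ => true) (const _) hc using 4 with O x
  cases b O x <;> rfl

theorem xor (hb : PolyTime fun O x => ofBool (b O x)) (hc : PolyTime fun O x => ofBool (c O x)) :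
    PolyTime fun O x => ofBool (b O x ^^ c O x) := by
  convert hb.ite_bool hc.not hc using 4 with O x
  cases b O x <;> simp

/-- The comparison is unrolled along the fixed tree `d` into finitely many tests, so no loop is
needed. -/
theorem beq_const (hf : PolyTime f) (d : Data) : PolyTime fun O x => ofBool (d.beq (f O x)) := by
  induction d generalizing f with
  | nil =>
    convert hf.truthy.not using 4 with O x
    cases f O x <;> rfl
  | cons a b iha ihb =>
    convert hf.truthy.and ((iha hf.head).and (ihb hf.tail)) using 4 with O x
    cases f O x <;> simp [beq]

/-- A test that is computed in constant time may be applied to the answer of the oracle, whatever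
the size of this answer. -/
theorem test_query {β : Data → Bool} (T : Prog) (k : ℕ)
    (hT : ∀ O y, ∃ t ≤ k, Eval O T y (ofBool (β y)) t) (hf : PolyTime f) :
    PolyTime fun O x => ofBool (β (O (f O x))) := by
  -- The query costs `x.size + 1`, the test at most `k`, the composition 1, and the resulting truth
  -- value has size at most 3; this is where `k + 5` comes from.
  refine comp (f := fun O x => ofBool (β (O x)))
    ⟨Prog.comp T Prog.query, Polynomial.X + Polynomial.C (k + 5), fun O x => ?_⟩ hf
  obtain ⟨t, ht, ht'⟩ := hT O (O x)
  refine ⟨_, Eval.comp (Eval.query x) ht', ?_⟩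
  have := size_ofBool_le (β (O x))
  simp only [Polynomial.eval_add, Polynomial.eval_X, Polynomial.eval_C]
  omega

theorem query_truthy (hf : PolyTime f) : PolyTime fun O x => ofBool (O (f O x)).truthy := by
  refine test_query (β := Data.truthy) (Prog.cond Prog.id (Prog.cons Prog.nil Prog.nil) Prog.nil)
    8 (fun O y => ?_) hf
  cases y with
  | nil => exact ⟨3, by norm_num, Eval.cond_false (Eval.id _) (Eval.nil _)⟩
  | cons a b =>
    exact ⟨8, le_rfl, Eval.cond_true (Eval.id _) (by simp) (Eval.cons (Eval.nil _) (Eval.nil _))⟩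

end PolyTime

/-! ### Iteration over lists -/

/-- The loop state consists of the remaining list, the accumulator and a fixed context; its head is
`nil` exactly when the list is used up. A round costs the body plus 2, and the final test costs 2.
The time bound `B` is required only on states that actually occur, so it may rely on bounds for the
intermediate accumulators. -/
theorem exists_eval_loop {O : Data → Data} {body : Prog} {step : Data → Data → Data} {ctx : Data}
    {B : ℕ} (l : List Data) (acc : Data)
    (h : ∀ l₁ a l₂, l = l₁ ++ a :: l₂ → ∃ t ≤ B,
      Eval O body (cons (ofList (a :: l₂)) (cons (l₁.foldl step acc) ctx))
        (cons (ofList l₂) (cons (step (l₁.foldl step acc) a) ctx)) t) :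
    ∃ t ≤ l.length * (B + 2) + 2,
      Eval O (Prog.loop Prog.head body) (cons (ofList l) (cons acc ctx))
        (cons nil (cons (l.foldl step acc) ctx)) t := by
  induction l generalizing acc with
  | nil => exact ⟨2, by simp, Eval.loop_stop (Eval.head _)⟩
  | cons a l ih =>
    obtain ⟨t, ht, ht'⟩ := h [] a l rfl
    obtain ⟨u, hu, hu'⟩ := ih (step acc a) fun l₁ a' l₂ hl => by
      simpa using h (a :: l₁) a' l₂ (by simp [hl])
    refine ⟨_, ?_, Eval.loop_step (Eval.head _) (by simp) ht' hu'⟩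
    simp only [List.length_cons, Nat.succ_mul] at *
    omega

namespace PolyTime

variable {f g l init : (Data → Data) → Data → Data}
  {step : (Data → Data) → Data → Data → Data → Data}

/-- Polynomial-time steps alone could make the accumulator grow exponentially. The hypothesis on all
prefixes keeps every intermediate state polynomially large, and the number of rounds is at most the
size of the list. -/
theorem foldl (hstep : PolyTime fun O p => step O p.head p.tail.head p.tail.tail)
    (hl : PolyTime l) (hinit : PolyTime init) (q : Polynomial ℕ)
    (hq : ∀ O x l', l' <+: (l O x).toList →
      (l'.foldl (step O x) (init O x)).size ≤ q.eval x.size) :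
    PolyTime fun O x => (l O x).toList.foldl (step O x) (init O x) := by
  obtain ⟨body, p, hp⟩ : PolyTime fun O s => Data.cons s.head.tail
      (Data.cons (step O s.tail.tail s.tail.head s.head.head) s.tail.tail) :=
    id.head.tail.cons ((hstep.comp (id.tail.tail.cons (id.tail.head.cons id.head.head))).cons
      id.tail.tail)
  obtain ⟨r, hr⟩ := hl.exists_size_le
  suffices h : PolyTime fun O x => Data.cons nil
      (Data.cons ((l O x).toList.foldl (step O x) (init O x)) x) from h.tail.head
  suffices h : ∃ (P : Prog) (p : Polynomial ℕ), ∀ O x, ∃ t ≤ p.eval x.size,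
      Eval O P (Data.cons (l O x) (Data.cons (init O x) x)) (Data.cons nil
        (Data.cons ((l O x).toList.foldl (step O x) (init O x)) x)) t by
    obtain ⟨P, p, hp⟩ := h
    obtain ⟨Q, p', hQ⟩ := hl.cons (hinit.cons id)
    refine ⟨Prog.comp P Q, p' + p + q + Polynomial.X + 4, fun O x => ?_⟩
    obtain ⟨t, ht, ht'⟩ := hp O x
    obtain ⟨u, hu, hu'⟩ := hQ O x
    refine ⟨_, Eval.comp hu ht', ?_⟩
    have := hq O x _ List.prefix_rfl
    simp only [Polynomial.eval_add, Polynomial.eval_X, Polynomial.eval_ofNat, size_cons,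
      size_nil] at *
    omega
  -- `r` bounds the number of rounds, and `r + q + X + 2` bounds the size of a state: remaining
  -- list, accumulator, input and two pairing nodes.
  refine ⟨Prog.loop Prog.head body, r * (p.comp (r + q + Polynomial.X + 2) + 2) + 2,
    fun O x => ?_⟩
  obtain ⟨t, ht, ht'⟩ := exists_eval_loop (O := O) (body := body) (step := step O x) (ctx := x)
    (B := p.eval (r.eval x.size + q.eval x.size + x.size + 2)) (l O x).toList (init O x) (by
      intro l₁ a l₂ h
      obtain ⟨t, ht, ht'⟩ := hp O (Data.cons (ofList (a :: l₂))
        (Data.cons (l₁.foldl (step O x) (init O x)) x))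
      refine ⟨t, ?_, ht⟩
      refine (Nat.le_of_add_right_le ht').trans (eval_mono p ?_)
      have h₁ := hq O x l₁ (by rw [h]; exact List.prefix_append _ _)
      have h₂ := size_ofList_le_of_suffix (l := a :: l₂) (l' := (l O x).toList)
        (by rw [h]; exact List.suffix_append _ _)
      rw [ofList_toList] at h₂
      have h₃ := hr O x
      rw [size_cons, size_cons]
      omega)
  rw [ofList_toList] at ht'
  refine ⟨t, ht.trans ?_, ht'⟩
  simp only [Polynomial.eval_add, Polynomial.eval_mul, Polynomial.eval_comp, Polynomial.eval_X,
    Polynomial.eval_ofNat]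
  gcongr
  exact (length_toList_le _).trans (hr O x)

/-- Iteration over a list, where each step increases the size of the accumulator by a polynomially
bounded amount. -/
theorem foldl_of_size_le (hstep : PolyTime fun O p => step O p.head p.tail.head p.tail.tail)
    (hl : PolyTime l) (hinit : PolyTime init) (q : Polynomial ℕ)
    (hq : ∀ O x acc, ∀ a ∈ (l O x).toList, (step O x acc a).size ≤ acc.size + q.eval x.size) :
    PolyTime fun O x => (l O x).toList.foldl (step O x) (init O x) := by
  obtain ⟨r, hr⟩ := hl.exists_size_le
  obtain ⟨s, hs⟩ := hinit.exists_size_le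
  refine foldl hstep hl hinit (s + r * q) fun O x l' hl' => ?_
  have key : ∀ acc, (l'.foldl (step O x) acc).size ≤ acc.size + l'.length * q.eval x.size := by
    have hm : ∀ a ∈ l', a ∈ (l O x).toList := fun a ha => hl'.subset ha
    clear hl'
    induction l' with
    | nil => simp
    | cons a l' ih =>
      intro acc
      have h₁ := ih (fun b hb => hm b (by simp [hb])) (step O x acc a)
      have h₂ := hq O x acc a (hm a (by simp))
      simp only [List.foldl_cons, List.length_cons, Nat.succ_mul]
      omega
  have h₁ := key (init O x)
  have h₂ : l'.length ≤ r.eval x.size :=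
    (hl'.length_le.trans (length_toList_le _)).trans (hr O x)
  have h₃ := Nat.mul_le_mul_right (q.eval x.size) h₂
  have h₄ := hs O x
  simp only [Polynomial.eval_add, Polynomial.eval_mul]
  omega

theorem reverse (hf : PolyTime f) : PolyTime fun O x => ofList (f O x).toList.reverse := by
  have : PolyTime fun O x => (f O x).toList.foldl (fun acc a => Data.cons a acc) nil := by
    refine foldl_of_size_le (step := fun _ _ acc a => Data.cons a acc) (id.tail.tail.cons
      id.tail.head) hf (const nil) (hf.exists_size_le.choose + 1) fun O x acc a ha => ?_
    have := hf.exists_size_le.choose_spec O x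
    have := size_le_of_mem ha
    simp
    omega
  convert this using 3 with O x
  have key : ∀ (l : List Data) (acc : Data), l.foldl (fun acc a => Data.cons a acc) acc =
      ofList (l.reverse ++ acc.toList) := by
    intro l
    induction l <;> simp_all
  simp [key]

theorem append (hf : PolyTime f) (hg : PolyTime g) :
    PolyTime fun O x => ofList ((f O x).toList ++ (g O x).toList) := by
  have : PolyTime fun O x =>
      (ofList (f O x).toList.reverse).toList.foldl (fun acc a => Data.cons a acc) (g O x) := by
    refine foldl_of_size_le (step := fun _ _ acc a => Data.cons a acc) (id.tail.tail.cons
      id.tail.head) hf.reverse hg (hf.exists_size_le.choose + 1) fun O x acc a ha => ?_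
    have := hf.exists_size_le.choose_spec O x
    have := size_le_of_mem (d := f O x) (a := a) (by simpa using ha)
    simp
    omega
  convert this using 3 with O x
  have key : ∀ (l : List Data) (acc : Data), l.foldl (fun acc a => Data.cons a acc) acc =
      ofList (l.reverse ++ acc.toList) := by
    intro l
    induction l <;> simp_all
  simp [key]

theorem flatMap {F : (Data → Data) → Data → Data → Data}
    (hF : PolyTime fun O p => F O p.head p.tail) (hl : PolyTime l) :
    PolyTime fun O x => Data.flatMap (F O x) (l O x) := by
  obtain ⟨r, hr⟩ := hl.exists_size_le
  obtain ⟨s, hs⟩ := hF.exists_size_le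
  -- The pieces are prepended along the reversed list, so a step enlarges the accumulator only by
  -- the new piece and the order comes out right.
  have : PolyTime fun O x => (ofList (l O x).toList.reverse).toList.foldl
      (fun acc a => ofList ((F O x a).toList ++ acc.toList)) nil := by
    refine foldl_of_size_le (step := fun O x acc a => ofList ((F O x a).toList ++ acc.toList))
      ((hF.comp (id.head.cons id.tail.tail)).append id.tail.head) hl.reverse (const nil)
      (s.comp (Polynomial.X + r + 1)) fun O x acc a ha => ?_
    have h₁ := hr O x
    have h₂ := size_le_of_mem (d := l O x) (a := a) (by simpa using ha)
    have h₃ := size_ofList_append (F O x a).toList acc.toList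
    have h₄ := hs O (Data.cons x a)
    have h₅ := eval_mono s (show (Data.cons x a).size ≤ x.size + r.eval x.size + 1 by
      simp; omega)
    simp at h₃ h₄ h₅ ⊢
    omega
  convert this using 3 with O x
  rw [toList_ofList, Data.flatMap, List.foldl_reverse]
  generalize (l O x).toList = l
  induction l with
  | nil => rfl
  | cons a l ih => rw [List.flatMap_cons, List.foldr_cons, ← ih, toList_ofList]

end PolyTime

/-! ### Binary arithmetic -/

/-- The natural number with the given binary digits, least significant digit first. -/
def listVal (l : List Data) : ℕ := Nat.ofDigits 2 (l.map fun a => a.truthy.toNat)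

@[simp] theorem listVal_nil : listVal [] = 0 := rfl

@[simp] theorem listVal_cons (a : Data) (l : List Data) :
    listVal (a :: l) = a.truthy.toNat + 2 * listVal l := by
  simp [listVal, Nat.ofDigits_cons]

theorem listVal_append (l l' : List Data) :
    listVal (l ++ l') = listVal l + 2 ^ l.length * listVal l' := by
  simp [listVal, Nat.ofDigits_append]

theorem listVal_lt (l : List Data) : listVal l < 2 ^ l.length := by
  induction l with
  | nil => simp
  | cons a l ih =>
    have := Bool.toNat_le a.truthy
    rw [listVal_cons, List.length_cons, pow_succ]
    omega

theorem listVal_replicate_nil (n : ℕ) : listVal (List.replicate n nil) = 0 := by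
  induction n <;> simp_all [List.replicate_succ]

@[simp] theorem listVal_toList_ofNat (n : ℕ) : listVal (ofNat n).toList = n := by
  rw [ofNat, toList_ofList, listVal, List.map_map]
  conv_rhs => rw [← Nat.ofDigits_digits 2 n]
  rw [Nat.digits_two_eq_bits]
  congr 1
  refine List.map_congr_left fun b _ => ?_
  cases b <;> rfl

theorem ofNat_zero : ofNat 0 = nil := by simp [ofNat]

theorem truthy_ofNat (n : ℕ) : (ofNat n).truthy = decide (n ≠ 0) := by
  rcases eq_or_ne n 0 with rfl | hn
  · simp [ofNat_zero]
  · have : ofNat n ≠ nil := fun h => hn (by rw [← listVal_toList_ofNat n, h]; rfl)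
    simp [truthy_eq_true.2 this, hn]

/-- Each binary digit takes one list node and a tree of size at most 3. -/
theorem size_ofNat_le {n k : ℕ} (h : n < 2 ^ k) : (ofNat n).size ≤ 4 * k + 1 := by
  have h₁ : n.bits.length ≤ k := by
    rw [Nat.size_eq_bits_len]
    exact Nat.size_le.2 h
  have h₂ : ∀ l : List Bool, (ofList (l.map ofBool)).size ≤ 4 * l.length + 1 := by
    intro l
    induction l with
    | nil => simp
    | cons b l ih =>
      have := size_ofBool_le b
      simp
      omega
  exact (h₂ _).trans (by omega)

namespace Data

/-- Appends a most significant digit to the reversed binary expansion of a number. -/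
def trimStep (acc a : Data) : Data :=
  cond (acc.truthy || a.truthy) (cons (ofBool a.truthy) acc) nil

/-- The binary expansion, without leading zeros, of the number with the given digits, most
significant digit first. -/
def trim (d : Data) : Data := d.toList.foldl trimStep nil

/-- One step of the addition (of the subtraction if `s`) of binary numbers. The accumulator
contains the remaining digits of the second number, the carry, and the digits of the result. -/
def addSubStep (s : Bool) (acc a : Data) : Data :=
  cons acc.head.tail
    (cons (ofBool (cond acc.tail.head.truthy ((a.truthy ^^ s) || acc.head.head.truthy)
        ((a.truthy ^^ s) && acc.head.head.truthy)))
      (cons (ofBool (a.truthy ^^ (acc.head.head.truthy ^^ acc.tail.head.truthy))) acc.tail.tail))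

/-- The sum (the difference if `s`) of two binary numbers: carry, and the digits of the result,
most significant digit first. -/
def addSub (s : Bool) (x y : Data) : Data :=
  ((ofList (x.toList ++ (flatMap (fun _ => cons nil nil) y).toList)).toList.foldl (addSubStep s)
    (cons y (cons nil nil))).tail

/-- Addition of binary numbers. -/
def add (x y : Data) : Data := trim (addSub false x y)

/-- Subtraction of binary numbers. -/
def sub (x y : Data) : Data := trim (addSub true x y).tail

/-- The strict order of binary numbers. -/
def lt (x y : Data) : Bool := (addSub true x y).head.truthy

/-- One step of the multiplication by `y`. -/
def mulStep (y acc a : Data) : Data := add (cond a.truthy y nil) (cons nil acc)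

/-- Multiplication of binary numbers. -/
def mul (x y : Data) : Data := (ofList x.toList.reverse).toList.foldl (mulStep y) nil

end Data

/-- An empty accumulator stands for 0, and a zero digit leaves it empty. Leading zeros thus
disappear, as the canonical form `ofNat` demands. -/
theorem trimStep_ofNat (n : ℕ) (a : Data) :
    trimStep (ofNat n) a = ofNat (2 * n + a.truthy.toNat) := by
  cases ha : a.truthy
  · rcases eq_or_ne n 0 with rfl | hn
    · simp [trimStep, ha, ofNat_zero]
    · rw [trimStep, truthy_ofNat]
      simp [ha, hn, ofNat, Nat.bit0_bits n hn]
  · simp [trimStep, ha, ofNat, Nat.bit1_bits]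

theorem foldl_trimStep (l : List Data) (n : ℕ) :
    l.foldl trimStep (ofNat n) = ofNat (n * 2 ^ l.length + listVal l.reverse) := by
  induction l generalizing n with
  | nil => simp
  | cons a l ih =>
    rw [List.foldl_cons, trimStep_ofNat, ih, List.reverse_cons, listVal_append]
    congr 1
    simp [pow_succ]
    ring

theorem trim_eq (d : Data) : trim d = ofNat (listVal d.toList.reverse) := by
  rw [trim, ← ofNat_zero, foldl_trimStep]
  simp

/-- Invariant of the school algorithm: the digits produced so far, plus the place value reached
times the signed sum of carry and unread part of `y`, account for everything except the unread
digits of the first number. Working in `ℤ` with a sign treats carry and borrow at once; one step is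
a check over the three bits and the sign. -/
theorem foldl_addSubStep (s : Bool) (l : List Data) (y c out : Data) :
    ∃ y' c' out', l.foldl (addSubStep s) (cons y (cons c out)) = cons y' (cons c' out') ∧
      y'.toList = y.toList.drop l.length ∧
      out'.toList.length = out.toList.length + l.length ∧
      (listVal out'.toList.reverse : ℤ) + 2 ^ out'.toList.length *
          (cond s (-1) 1 * (c'.truthy.toNat + listVal y'.toList)) =
        listVal out.toList.reverse + 2 ^ out.toList.length *
          (listVal l + cond s (-1) 1 * (c.truthy.toNat + listVal y.toList)) := by
  induction l generalizing y c out with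
  | nil => exact ⟨y, c, out, by simp⟩
  | cons a l ih =>
    rw [List.foldl_cons]
    obtain ⟨y', c', out', h, h₁, h₂, h₃⟩ := ih (addSubStep s (cons y (cons c out)) a).head
      (addSubStep s (cons y (cons c out)) a).tail.head
      (addSubStep s (cons y (cons c out)) a).tail.tail
    refine ⟨y', c', out', h, ?_, ?_, ?_⟩
    · rw [h₁]
      cases y <;> simp [addSubStep]
    · rw [h₂]
      simp [addSubStep]
      omega
    · rw [h₃]
      have hy : listVal y.toList = y.head.truthy.toNat + 2 * listVal y.tail.toList := by
        cases y <;> simp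
      rw [hy]
      simp only [addSubStep, head_cons, tail_cons, toList_cons, List.reverse_cons,
        listVal_append, List.length_cons, listVal_cons, truthy_ofBool, List.length_reverse]
      generalize a.truthy = a
      generalize y.head.truthy = b
      generalize c.truthy = c
      cases a <;> cases b <;> cases c <;> cases s <;> simp [pow_succ] <;> ring

/-- The first number is padded with as many zeros as `y` has digits, so the fold consumes `y`
completely and only the final carry remains. -/
theorem addSub_eq (s : Bool) (x y : Data) :
    ∃ c out, addSub s x y = cons c out ∧
      (listVal out.toList.reverse : ℤ) + 2 ^ out.toList.length * (cond s (-1) 1 * c.truthy.toNat) =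
        listVal x.toList + cond s (-1) 1 * listVal y.toList := by
  have hp : (flatMap (fun _ => cons nil nil) y).toList = List.replicate y.toList.length nil := by
    rw [toList_flatMap]
    generalize y.toList = l
    induction l <;> simp_all [List.replicate_succ]
  obtain ⟨y', c, out, h, h₁, -, h₂⟩ := foldl_addSubStep s
    (ofList (x.toList ++ (flatMap (fun _ => cons nil nil) y).toList)).toList y nil nil
  refine ⟨c, out, ?_, ?_⟩
  · rw [addSub, h, tail_cons]
  · rw [toList_ofList, hp] at h₁ h₂
    rw [List.drop_of_length_le (by simp)] at h₁
    rw [h₁, listVal_append, listVal_replicate_nil] at h₂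
    simpa using h₂

theorem add_eq (x y : Data) : add x y = ofNat (listVal x.toList + listVal y.toList) := by
  obtain ⟨c, out, h, h'⟩ := addSub_eq false x y
  rw [add, h, trim_eq, toList_cons, List.reverse_cons, listVal_append]
  congr 1
  zify
  simp at h' ⊢
  linarith

/-- The output digits form a number in `[0, 2 ^ length)`, so a borrow is left over exactly when the
difference is negative. -/
theorem lt_eq (x y : Data) : lt x y = decide (listVal x.toList < listVal y.toList) := by
  obtain ⟨c, out, h, h'⟩ := addSub_eq true x y
  have h₁ := listVal_lt out.toList.reverse
  rw [List.length_reverse] at h₁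
  zify at h₁
  rw [Bool.eq_iff_iff, decide_eq_true_iff, lt, h, head_cons]
  cases hc : c.truthy <;> simp [hc] at h' ⊢ <;> omega

theorem sub_eq {x y : Data} (hxy : listVal y.toList ≤ listVal x.toList) :
    sub x y = ofNat (listVal x.toList - listVal y.toList) := by
  obtain ⟨c, out, h, h'⟩ := addSub_eq true x y
  have h₁ := lt_eq x y
  rw [lt, h, head_cons, decide_eq_false (by omega)] at h₁
  rw [sub, h, trim_eq, tail_cons]
  congr 1
  simp [h₁] at h'
  omega

/-- Horner's scheme, starting from the most significant digit. -/
theorem foldl_mulStep (y : Data) (l : List Data) :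
    l.foldl (mulStep y) nil = ofNat (listVal l.reverse * listVal y.toList) := by
  induction l using List.reverseRecOn with
  | nil => simp [ofNat_zero]
  | append_singleton l a ih =>
    rw [List.foldl_append, ih, List.foldl_cons, List.foldl_nil, mulStep, add_eq]
    congr 1
    cases ha : a.truthy <;> simp [ha] <;> ring

theorem mul_eq (x y : Data) : mul x y = ofNat (listVal x.toList * listVal y.toList) := by
  rw [mul, foldl_mulStep]
  simp

/-! ### Running time of the binary arithmetic. -/

namespace PolyTime

variable {f g : (Data → Data) → Data → Data}

theorem trim (hf : PolyTime f) : PolyTime fun O x => (f O x).trim := by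
  refine foldl_of_size_le (step := fun _ _ acc a => trimStep acc a)
    ((id.tail.head.truthy.or id.tail.tail.truthy).ite (id.tail.tail.truthy.cons id.tail.head)
      (const _)) hf (const nil) 4 fun O x acc a _ => ?_
  have := size_ofBool_le a.truthy
  rw [trimStep]
  cases acc.truthy || a.truthy <;> simp; omega

theorem addSub (s : Bool) (hf : PolyTime f) (hg : PolyTime g) :
    PolyTime fun O x => (f O x).addSub s (g O x) := by
  have ha : PolyTime fun _ p => p.tail.tail := id.tail.tail
  have hb : PolyTime fun _ p => p.tail.head.head.head := id.tail.head.head.head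
  have hc : PolyTime fun _ p => p.tail.head.tail.head := id.tail.head.tail.head
  have hs : PolyTime fun _ p => ofBool (p.tail.tail.truthy ^^ s) := ha.truthy.xor (const _)
  refine (foldl_of_size_le (step := fun _ _ acc a => addSubStep s acc a)
    (id.tail.head.head.tail.cons ((hc.truthy.ite_bool (hs.or hb.truthy) (hs.and hb.truthy)).cons
      ((ha.truthy.xor (hb.truthy.xor hc.truthy)).cons id.tail.head.tail.tail)))
    (hf.append (flatMap (F := fun _ _ _ => Data.cons nil nil) (const _) hg)) (hg.cons (const _))
    10 fun O x acc a _ => ?_).tail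
  rw [addSubStep]
  generalize (cond _ _ _ : Bool) = b
  generalize (a.truthy ^^ _) = b'
  have h₁ := size_ofBool_le b
  have h₂ := size_ofBool_le b'
  cases acc with
  | nil => simp; omega
  | cons u v =>
    have h₃ := size_tail_le u
    have h₄ := size_tail_le v
    simp
    omega

theorem add (hf : PolyTime f) (hg : PolyTime g) : PolyTime fun O x => (f O x).add (g O x) :=
  (hf.addSub false hg).trim

theorem sub (hf : PolyTime f) (hg : PolyTime g) : PolyTime fun O x => (f O x).sub (g O x) :=
  (hf.addSub true hg).tail.trim

theorem lt (hf : PolyTime f) (hg : PolyTime g) :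
    PolyTime fun O x => ofBool ((f O x).lt (g O x)) :=
  (hf.addSub true hg).head.truthy

theorem mul (hf : PolyTime f) (hg : PolyTime g) : PolyTime fun O x => (f O x).mul (g O x) := by
  obtain ⟨r, hr⟩ := hf.exists_size_le
  obtain ⟨s, hs⟩ := hg.exists_size_le
  -- The intermediate accumulators are bounded by their values: after reading `l'` the value is
  -- below `2` to the sum of the lengths of `l'` and of the second factor, and a digit takes at most
  -- 4 nodes.
  refine foldl (step := fun O x acc a => mulStep (g O x) acc a)
    ((id.tail.tail.truthy.ite (hg.comp id.head) (const nil)).add ((const nil).cons id.tail.head))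
    hf.reverse (const nil) (4 * (r + s) + 1) fun O x l' hl' => ?_
  rw [foldl_mulStep]
  refine (size_ofNat_le (k := l'.length + (g O x).toList.length) ?_).trans ?_
  · rw [pow_add]
    refine Nat.mul_lt_mul'' ?_ (listVal_lt _)
    simpa using listVal_lt l'.reverse
  · have h₁ := hl'.length_le
    have h₂ := length_toList_le (f O x)
    have h₃ := length_toList_le (g O x)
    have h₄ := hr O x
    have h₅ := hs O x
    simp at h₁ ⊢
    omega

end PolyTime

/-! ### Fractions -/

/-- `f` consists of the binary expansions of `P`, `N` and `q`, where `r = (P - N) / q`. -/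
def IsFrac (f : Data) (r : ℝ) : Prop :=
  ∃ P N q : ℕ, 0 < q ∧ f = cons (ofNat P) (cons (ofNat N) (ofNat q)) ∧ r = ((P : ℝ) - N) / q

namespace Data

/-- Transforms the representation of a rational number. -/
def toFrac (v : Data) : Data :=
  cons (cond v.head.truthy nil v.tail.head)
    (cons (cond v.head.truthy v.tail.head nil) v.tail.tail.head)

/-- The difference of two fractions. -/
def diff (f g : Data) : Data :=
  cons (add (mul f.head g.tail.tail) (mul g.tail.head f.tail.tail))
    (cons (add (mul f.tail.head g.tail.tail) (mul g.head f.tail.tail))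
      (mul f.tail.tail g.tail.tail))

/-- The order of fractions. -/
def fracLE (f g : Data) : Bool := !(lt (diff f g).tail.head (diff f g).head)

/-- The representation of a rational number. -/
def ofFrac (f : Data) : Data :=
  cond (lt f.head f.tail.head)
    (cons (ofBool true) (cons (sub f.tail.head f.head) (cons f.tail.tail nil)))
    (cons (ofBool false) (cons (sub f.head f.tail.head) (cons f.tail.tail nil)))

end Data

theorem isFrac_toFrac (p : ℤ) (q : ℕ) (hq : 0 < q) :
    IsFrac (toFrac (ofList [ofBool (decide (p < 0)), ofNat p.natAbs, ofNat q]))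
      ((p : ℝ) / (q : ℝ)) := by
  by_cases hp : p < 0
  · refine ⟨0, p.natAbs, q, hq, ?_, ?_⟩
    · simp [toFrac, hp, ofNat_zero]
    · have h : (p.natAbs : ℝ) = ((p.natAbs : ℤ) : ℝ) := by simp
      rw [h, Int.ofNat_natAbs_of_nonpos hp.le]
      simp
  · refine ⟨p.natAbs, 0, q, hq, ?_, ?_⟩
    · simp [toFrac, hp, ofNat_zero]
    · have h : (p.natAbs : ℝ) = ((p.natAbs : ℤ) : ℝ) := by simp
      rw [h, Int.natAbs_of_nonneg (not_lt.1 hp)]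
      simp

/-- Cross-multiplication with positive and negative parts kept apart, so only sums and products of
natural numbers occur. Fractions are never reduced, since every fraction with positive denominator
is an admissible representation. -/
theorem IsFrac.diff {f g : Data} {r s : ℝ} (hf : IsFrac f r) (hg : IsFrac g s) :
    IsFrac (diff f g) (r - s) := by
  obtain ⟨P, N, q, hq, rfl, rfl⟩ := hf
  obtain ⟨P', N', q', hq', rfl, rfl⟩ := hg
  refine ⟨P * q' + N' * q, N * q' + P' * q, q * q', by positivity, ?_, ?_⟩
  · simp [Data.diff, add_eq, mul_eq]
  · push_cast
    field_simp
    ring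

theorem IsFrac.fracLE_iff {f g : Data} {r s : ℝ} (hf : IsFrac f r) (hg : IsFrac g s) :
    fracLE f g = true ↔ r ≤ s := by
  obtain ⟨P, N, q, hq, h, h'⟩ := hf.diff hg
  rw [fracLE, h, ← sub_nonpos, h',
    div_le_iff₀ (by exact_mod_cast hq), zero_mul, sub_nonpos]
  simp [lt_eq]

theorem IsFrac.codesExtRat {f : Data} {r : ℝ} (hf : IsFrac f r) :
    CodesExtRat (r : EReal) (ofFrac f) := by
  obtain ⟨P, N, q, hq, rfl, rfl⟩ := hf
  have h := CodesExtRat.rat (P - N) q hq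
  push_cast at h
  convert h using 1
  rw [ofFrac]
  simp only [head_cons, tail_cons, lt_eq, listVal_toList_ofNat]
  by_cases hPN : P < N
  · rw [sub_eq (x := ofNat N) (y := ofNat P) (by simpa using hPN.le)]
    simp only [hPN, listVal_toList_ofNat, sub_neg, Nat.cast_lt, ofList_cons, ofList_nil]
    simp only [decide_true, cond_true]
    congr 3
    omega
  · rw [sub_eq (x := ofNat P) (y := ofNat N) (by simpa using hPN)]
    simp only [hPN, listVal_toList_ofNat, sub_neg, Nat.cast_lt, ofList_cons, ofList_nil]
    simp only [decide_false, cond_false]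
    congr 3
    omega

namespace PolyTime

variable {f g : (Data → Data) → Data → Data}

theorem toFrac (hf : PolyTime f) : PolyTime fun O x => (f O x).toFrac :=
  (hf.head.truthy.ite (const nil) hf.tail.head).cons
    ((hf.head.truthy.ite hf.tail.head (const nil)).cons hf.tail.tail.head)

theorem diff (hf : PolyTime f) (hg : PolyTime g) : PolyTime fun O x => (f O x).diff (g O x) :=
  ((hf.head.mul hg.tail.tail).add (hg.tail.head.mul hf.tail.tail)).cons
    (((hf.tail.head.mul hg.tail.tail).add (hg.head.mul hf.tail.tail)).cons
      (hf.tail.tail.mul hg.tail.tail))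

theorem fracLE (hf : PolyTime f) (hg : PolyTime g) :
    PolyTime fun O x => ofBool ((f O x).fracLE (g O x)) :=
  ((hf.diff hg).tail.head.lt (hf.diff hg).head).not

theorem ofFrac (hf : PolyTime f) : PolyTime fun O x => (f O x).ofFrac :=
  (hf.head.lt hf.tail.head).ite
    ((const _).cons ((hf.tail.head.sub hf.head).cons (hf.tail.tail.cons (const nil))))
    ((const _).cons ((hf.head.sub hf.tail.head).cons (hf.tail.tail.cons (const nil))))

end PolyTime

/-- Lets `choose!` pick codes by functions that are defined everywhere. -/
instance : Nonempty Data := ⟨nil⟩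

/-! ### Representations of sets -/

section Representations

variable {A B : Type*} {R : A → Data → Prop} {R' : B → Data → Prop} {S : Set A} {w : Data}

theorem CodesSet.exists_mem (h : CodesSet R S w) {a : A} (ha : a ∈ S) : ∃ c ∈ w.toList, R a c := by
  obtain ⟨l, rfl, h₁, -⟩ := h
  simpa using h₁ a ha

theorem CodesSet.of_mem (h : CodesSet R S w) {c : Data} (hc : c ∈ w.toList) : ∃ a ∈ S, R a c := by
  obtain ⟨l, rfl, -, h₂⟩ := h
  exact h₂ c (by simpa using hc)

theorem codesSet_singleton {a : A} {c : Data} (h : R a c) : CodesSet R {a} (cons c nil) :=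
  ⟨[c], rfl, by simpa using h, by simpa using h⟩

theorem codesSet_empty : CodesSet R ∅ nil := ⟨[], rfl, by simp, by simp⟩

/-- Representing lists may have any order and repetitions, so concatenating representations of the
sets `G a` represents their union without sorting or removal of duplicates. Both reductions
transform instances in this way, level by level. -/
theorem CodesSet.flatMap {G : A → Set B} {F : Data → Data} (h : CodesSet R S w)
    (hF : ∀ a ∈ S, ∀ c, R a c → CodesSet R' (G a) (F c)) :
    CodesSet R' (⋃ a ∈ S, G a) (Data.flatMap F w) := by
  refine ⟨_, rfl, fun b hb => ?_, fun d hd => ?_⟩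
  · obtain ⟨a, ha, hb⟩ := Set.mem_iUnion₂.1 hb
    obtain ⟨c, hc, hac⟩ := h.exists_mem ha
    obtain ⟨d, hd, hbd⟩ := (hF a ha c hac).exists_mem hb
    exact ⟨d, List.mem_flatMap.2 ⟨c, hc, hd⟩, hbd⟩
  · obtain ⟨c, hc, hd⟩ := List.mem_flatMap.1 hd
    obtain ⟨a, ha, hac⟩ := h.of_mem hc
    obtain ⟨b, hb, hbd⟩ := (hF a ha c hac).of_mem hd
    exact ⟨b, Set.mem_iUnion₂.2 ⟨a, ha, hb⟩, hbd⟩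

theorem exists_codesSet (hS : S.Finite) (h : ∀ a ∈ S, ∃ c, R a c) : ∃ w, CodesSet R S w := by
  choose! c hc using h
  refine ⟨_, hS.toFinset.toList.map c, rfl, fun a ha => ⟨c a, ?_, hc a ha⟩, fun d hd => ?_⟩
  · exact List.mem_map.2 ⟨a, by simpa using ha, rfl⟩
  · obtain ⟨a, ha, rfl⟩ := List.mem_map.1 hd
    have ha : a ∈ S := by simpa using ha
    exact ⟨a, ha, hc a ha⟩

theorem IsExtRat.exists_codes {v : EReal} (hv : IsExtRat v) : ∃ c, CodesExtRat v c := by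
  rcases hv with rfl | rfl | ⟨q, rfl⟩
  · exact ⟨_, .bot⟩
  · exact ⟨_, .top⟩
  · have := CodesExtRat.rat q.num q.den q.den_pos
    rw [← Rat.cast_def] at this
    exact ⟨_, this⟩

theorem ofNat_injective : Function.Injective ofNat := fun m n h => by
  simpa using congrArg (fun d => listVal d.toList) h

theorem codeTuple_injective {e : A → ℕ} (he : Function.Injective e) {k : ℕ} :
    Function.Injective (codeTuple e : (Fin k → A) → Data) := fun x y h => by
  have h := congrArg toList h
  simp only [codeTuple, toList_ofList] at h
  have h := List.ofFn_injective h
  funext i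
  exact he (ofNat_injective (congrFun h i))

end Representations

/-! ### The optimal value and the sublevel sets -/

/-- The delicate case is `b = ⊥`: then `a - b` is `⊥` for `a = ⊥` and `⊤` otherwise, while `c + b =
⊥`, so `c < ⊤` is needed. For `b = ⊤` the equivalence would fail at `c = ⊥`. -/
theorem EReal_sub_le_iff {a b c : EReal} (hb : b < ⊤) (hc : c < ⊤) : a - b ≤ c ↔ a ≤ c + b := by
  induction b with
  | bot =>
    rw [EReal.add_bot, le_bot_iff]
    induction a with
    | bot => simp
    | top => simpa using hc.ne
    | coe a => simpa using hc.ne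
  | top => simp at hb
  | coe b => exact EReal.sub_le_iff_le_add (by simp) (by simp)

namespace TVCSPInstance

variable {D : Type*} (I : TVCSPInstance D)

theorem value_le_iff (s : Fin I.numVars → D) (γ : EReal) :
    I.value s ≤ γ ↔ ∀ c ∈ I.constraints, ∀ x, c.ρ (s ∘ x) - c.σ x ≤ γ := by
  simp [value]

/-- A finite nonempty family attains its infimum. There may be no assignment at all, when `D` is
empty and variables exist; then the infimum is `⊤`. -/
theorem opt_eq_top_or [Finite D] : I.opt = ⊤ ∨ ∃ s, I.value s = I.opt := by
  rcases isEmpty_or_nonempty (Fin I.numVars → D) with h | h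
  · exact Or.inl (by simp [opt])
  · exact Or.inr (exists_eq_ciInf_of_finite)

theorem opt_le_iff [Finite D] {γ : EReal} (hγ : γ < ⊤) : I.opt ≤ γ ↔ ∃ s, I.value s ≤ γ := by
  constructor
  · intro h
    rcases I.opt_eq_top_or with h' | ⟨s, h'⟩
    · rw [h'] at h
      exact absurd hγ h.not_gt
    · exact ⟨s, h'.trans_le h⟩
  · rintro ⟨s, hs⟩
    exact (iInf_le _ s).trans hs

end TVCSPInstance

/-! ### Reduction of the CSP to the tropical valued CSP -/

theorem finite_U {D : Type*} [Finite D] {𝒟 : Set (Σ k : ℕ, ((Fin k → D) → EReal))}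
    (h𝒟 : 𝒟.Finite) : (U 𝒟).Finite := by
  refine (h𝒟.biUnion (t := fun ρ => Set.range fun r : Set (Fin ρ.1 → D) =>
    (⟨ρ.1, r⟩ : Σ k : ℕ, Set (Fin k → D)))
    fun ρ _ => Set.finite_range _).subset ?_
  rintro _ ⟨ρ, hρ, α, -, rfl⟩
  exact Set.mem_biUnion hρ ⟨_, rfl⟩

/-- A sublevel set does not change when its level is lowered to the maximum of `ρ` on it, which is a
value of `ρ` and hence extended rational. An empty sublevel set is also the sublevel set at `⊥`. -/
theorem exists_extRat_of_mem_U {D : Type*} [Finite D]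
    {𝒟 : Set (Σ k : ℕ, ((Fin k → D) → EReal))}
    (hrat : ∀ ρ ∈ 𝒟, ∀ d : Fin ρ.1 → D, IsExtRat (ρ.2 d)) (r : Σ k : ℕ, Set (Fin k → D))
    (hr : r ∈ U 𝒟) :
    ∃ (ρ : (Fin r.1 → D) → EReal) (α : EReal), ⟨r.1, ρ⟩ ∈ 𝒟 ∧ IsExtRat α ∧ α < ⊤ ∧
      r.2 = sublevel ρ α := by
  obtain ⟨ρ, hρ, α, hα, rfl⟩ := hr
  rcases (sublevel ρ.2 α).eq_empty_or_nonempty with h | h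
  · refine ⟨ρ.2, ⊥, hρ, Or.inl rfl, bot_lt_top, Set.Subset.antisymm (by simp [h]) ?_⟩
    exact fun d hd => le_trans (Set.mem_ofPred.1 hd) bot_le
  · obtain ⟨d, hd, hmax⟩ := Set.exists_max_image (sublevel ρ.2 α) ρ.2 (Set.toFinite _) h
    refine ⟨ρ.2, ρ.2 d, hρ, hrat ρ hρ d, lt_of_le_of_lt hd hα, Set.Subset.antisymm hmax ?_⟩
    exact fun d' hd' => le_trans (Set.mem_ofPred.1 hd') hd

namespace Data

/-- Membership in a list. -/
def contains (l c : Data) : Bool := (flatMap (fun a => cond (c.beq a) (cons nil nil) nil) l).truthy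

/-- Whether an extended rational number is at most zero. -/
def nonpos (v : Data) : Bool :=
  cond v.tail.truthy (v.head.truthy || !v.tail.head.truthy) (!v.truthy)

end Data

theorem contains_iff {l c : Data} : contains l c = true ↔ c ∈ l.toList := by
  rw [contains, truthy_eq_true]
  constructor
  · intro h
    cases hl : flatMap (fun a => cond (c.beq a) (cons nil nil) nil) l with
    | nil => exact absurd hl h
    | cons b d =>
      obtain ⟨a, ha, hb⟩ := mem_flatMap.1 (show b ∈ (flatMap (fun a =>
        cond (c.beq a) (cons nil nil) nil) l).toList by simp [hl])
      cases hca : c.beq a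
      · simp [hca] at hb
      · rwa [beq_eq_true.1 hca]
  · intro h h'
    have : nil ∈ (flatMap (fun a => cond (c.beq a) (cons nil nil) nil) l).toList :=
      mem_flatMap.2 ⟨c, h, by simp [beq_eq_true.2 (rfl : c = c)]⟩
    simp [h'] at this

/-- Only the shape of the code matters: `⊥` and `⊤` are lists of length 0 and 1, a longer list is a
rational number, and its sign bit and the emptiness of its numerator decide. Hence a constant number
of inspections of an oracle answer suffices. -/
theorem CodesExtRat.nonpos_iff {v : EReal} {c : Data} (h : CodesExtRat v c) :
    nonpos c = true ↔ v ≤ 0 := by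
  cases h with
  | bot => simp [nonpos]
  | top => simp [nonpos]
  | rat p q hq =>
    have hq' : (0 : ℝ) < q := by exact_mod_cast hq
    rw [← EReal.coe_zero, EReal.coe_le_coe_iff, div_le_iff₀ hq', zero_mul]
    simp [nonpos, truthy_ofNat, le_iff_lt_or_eq]

/-- The relation `r` is the one that is listed by `b`. -/
noncomputable def listsRel {D : Type*} [Fintype D] (e : D → ℕ) {k : ℕ} (r : Set (Fin k → D))
    (b : Data) : Bool :=
  open Classical in
  ((Finset.univ : Finset (Fin k → D)).toList).all fun d =>
    !(decide (d ∈ r) ^^ contains b (codeTuple e d))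

/-- Tuples have unique codes, so looking up every tuple of `D^k` in `b` recovers the listed relation
whatever the order of the list. The tuples range over a fixed finite set, so this test can be built
into a program. -/
theorem listsRel_iff {D : Type*} [Fintype D] {e : D → ℕ} (he : Function.Injective e) {k : ℕ}
    {r r' : Set (Fin k → D)} {b : Data} (hb : CodesRel e r' b) :
    listsRel e r b = true ↔ r = r' := by
  have h : ∀ d, contains b (codeTuple e d) = true ↔ d ∈ r' := fun d => by
    rw [contains_iff]
    constructor
    · intro h
      obtain ⟨d', hd', h⟩ := hb.of_mem h
      rwa [codeTuple_injective he h]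
    · intro h
      obtain ⟨c, hc, rfl⟩ := hb.exists_mem h
      exact hc
  simp only [listsRel, List.all_eq_true, Finset.mem_toList, Finset.mem_univ, true_imp_iff]
  rw [Set.ext_iff]
  refine forall_congr' fun d => ?_
  rw [← h d]
  by_cases hd : d ∈ r <;> cases contains b (codeTuple e d) <;> simp [hd]

/-- Replaces the relation of a constraint by the first relation in the table that it equals: the
scope gets the value represented by `va`, the valued relation is represented by `vb`. -/
noncomputable def lookup {D : Type*} [Fintype D] (e : D → ℕ) (va vb : (Σ k : ℕ, Set (Fin k → D)) → Data) :
    List (Σ k : ℕ, Set (Fin k → D)) → Data → Data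
  | [], _ => nil
  | r :: T, u => cond ((ofNat r.1).beq u.head && listsRel e r.2 u.tail.tail.head)
      (cons (ofNat r.1) (cons (cons (cons u.tail.head (va r)) nil) (cons (vb r) nil)))
      (lookup e va vb T u)

theorem lookup_eq {D : Type*} [Fintype D] {e : D → ℕ} (he : Function.Injective e)
    {va vb : (Σ k : ℕ, Set (Fin k → D)) → Data} {T : List (Σ k : ℕ, Set (Fin k → D))}
    {r : Σ k : ℕ, Set (Fin k → D)} (hr : r ∈ T) {a b : Data} (hb : CodesRel e r.2 b) :
    lookup e va vb T (ofList [ofNat r.1, a, b]) =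
      ofList [ofNat r.1, ofList [cons a (va r)], vb r] := by
  induction T with
  | nil => simp at hr
  | cons r' T ih =>
    rw [lookup]
    by_cases h : r' = r
    · subst h
      simp [(listsRel_iff he hb).2 rfl, beq_eq_true.2 rfl]
    · rw [← ih ((List.mem_cons.1 hr).resolve_left (Ne.symm h))]
      -- Entries of another arity are rejected by the comparison of arities; for equal arity the
      -- comparison of relations decides.
      rw [(Bool.and_eq_false_iff.2 ?_ : (_ && _) = false), cond_false]
      obtain ⟨k, r⟩ := r
      obtain ⟨k', r'⟩ := r'
      by_cases hk : k' = k
      · subst hk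
        right
        rw [← Bool.not_eq_true]
        intro h'
        exact h (congrArg (Sigma.mk k') ((listsRel_iff he hb).1 h'))
      · left
        rw [← Bool.not_eq_true, beq_eq_true]
        exact fun h' => hk (ofNat_injective h')

/-! ### Running time of the reduction from the CSP. -/

namespace PolyTime

variable {f : (Data → Data) → Data → Data}

theorem contains_const (hf : PolyTime f) (c : Data) :
    PolyTime fun O x => ofBool (contains (f O x) c) :=
  (flatMap (F := fun _ _ a => cond (c.beq a) (Data.cons nil nil) nil)
    ((id.tail.beq_const c).ite (const _) (const _)) hf).truthy

theorem list_all {ι : Type*} {b : ι → (Data → Data) → Data → Bool}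
    (h : ∀ i, PolyTime fun O x => ofBool (b i O x)) (l : List ι) :
    PolyTime fun O x => ofBool (l.all fun i => b i O x) := by
  induction l with
  | nil => exact const _
  | cons i l ih => exact (h i).and ih

theorem lookup {D : Type*} [Fintype D] (e : D → ℕ) (va vb : (Σ k : ℕ, Set (Fin k → D)) → Data)
    (T : List (Σ k : ℕ, Set (Fin k → D))) (hf : PolyTime f) :
    PolyTime fun O x => lookup e va vb T (f O x) := by
  induction T with
  | nil => exact const _
  | cons r T ih =>
    refine ((hf.head.beq_const _).and (list_all (fun d => ?_) _)).ite ((const _).cons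
      (((hf.tail.head.cons (const _)).cons (const _)).cons (const _))) ih
    exact ((const _).xor (hf.tail.tail.head.contains_const _)).not

theorem query_nonpos (hf : PolyTime f) : PolyTime fun O x => ofBool (O (f O x)).nonpos := by
  refine test_query (β := Data.nonpos) (Prog.cond Prog.tail (Prog.cond Prog.head
    (Prog.cons Prog.nil Prog.nil) (Prog.cond (Prog.comp Prog.head Prog.tail) Prog.nil
    (Prog.cons Prog.nil Prog.nil))) (Prog.cond Prog.id Prog.nil (Prog.cons Prog.nil Prog.nil)))
    20 (fun O y => ?_) hf
  have htrue : ∀ x, Eval O (Prog.cons Prog.nil Prog.nil) x (ofBool true) 6 := fun x =>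
    Eval.cons (Eval.nil _) (Eval.nil _)
  match y with
  | .nil =>
    exact ⟨_, by norm_num, Eval.cond_false (Eval.tail _) (Eval.cond_false (Eval.id _) (htrue _))⟩
  | .cons a .nil =>
    exact ⟨_, by norm_num, Eval.cond_false (Eval.tail _)
      (Eval.cond_true (Eval.id _) (by simp) (Eval.nil _))⟩
  | .cons (.cons a b) (.cons c d) =>
    exact ⟨_, by norm_num, Eval.cond_true (Eval.tail _) (by simp)
      (Eval.cond_true (Eval.head _) (by simp) (htrue _))⟩
  | .cons .nil (.cons .nil d) =>
    exact ⟨_, by norm_num, Eval.cond_true (Eval.tail _) (by simp)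
      (Eval.cond_false (Eval.head _) (Eval.cond_false (Eval.comp (Eval.tail _) (Eval.head _))
        (htrue _)))⟩
  | .cons .nil (.cons (.cons a b) d) =>
    exact ⟨_, by norm_num, Eval.cond_true (Eval.tail _) (by simp)
      (Eval.cond_false (Eval.head _) (Eval.cond_true (Eval.comp (Eval.tail _) (Eval.head _))
        (by simp) (Eval.nil _)))⟩

end PolyTime

/-- The valued constraint that expresses that the value of `ρ` at the scope of `c` is at most
`α`. -/
noncomputable def CSPConstraint.toTV {V D : Type*}
    (ρ : ∀ r : (Σ k : ℕ, Set (Fin k → D)), (Fin r.1 → D) → EReal)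
    (α : (Σ k : ℕ, Set (Fin k → D)) → EReal) (c : CSPConstraint V D) : TVConstraint V D where
  arity := c.arity
  σ := open Classical in fun x => if x = c.scope then α ⟨c.arity, c.rel⟩ else ⊤
  ρ := ρ ⟨c.arity, c.rel⟩

theorem CSPConstraint.toTV_σ_scope {V D : Type*}
    (ρ : ∀ r : (Σ k : ℕ, Set (Fin k → D)), (Fin r.1 → D) → EReal)
    (α : (Σ k : ℕ, Set (Fin k → D)) → EReal) (c : CSPConstraint V D) :
    (c.toTV ρ α).σ c.scope = α ⟨c.arity, c.rel⟩ := if_pos rfl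

theorem CSPConstraint.toTV_σ_of_ne {V D : Type*}
    (ρ : ∀ r : (Σ k : ℕ, Set (Fin k → D)), (Fin r.1 → D) → EReal)
    (α : (Σ k : ℕ, Set (Fin k → D)) → EReal) (c : CSPConstraint V D) {x : Fin c.arity → V}
    (hx : x ≠ c.scope) : (c.toTV ρ α).σ x = ⊤ := if_neg hx

/-- Each relation of `U 𝒟` gets a fixed valued relation, a fixed level, and codes of both; the
program translates every constraint by this finite table and asks one query, whose answer is
compared with `0`. -/
theorem polyTimeReducible_CSP_TVCSP {D : Type*} [Fintype D] (e : D ≃ Fin (Fintype.card D))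
    (𝒟 : Set (Σ k : ℕ, ((Fin k → D) → EReal))) (h𝒟 : 𝒟.Finite)
    (hrat : ∀ ρ ∈ 𝒟, ∀ d : Fin ρ.1 → D, IsExtRat (ρ.2 d)) :
    PolyTimeReducible (CSP e (U 𝒟)) (TVCSP e 𝒟) := by
  have he : Function.Injective fun d => (e d : ℕ) := Fin.val_injective.comp e.injective
  choose! ρ α hρ hα hα' hr using exists_extRat_of_mem_U hrat
  choose! va hva using fun r hr => (hα r hr).exists_codes
  have : ∀ r ∈ U 𝒟, ∃ b, CodesValuedRel (fun d => (e d : ℕ)) (ρ r) b := fun r hr =>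
    exists_codesSet (Set.toFinite _) fun d _ =>
      let ⟨v, hv⟩ := (hrat _ (hρ r hr) d).exists_codes
      ⟨_, v, hv, rfl⟩
  choose! vb hvb using this
  let T := (finite_U h𝒟).toFinset.toList
  let F : Data → Data := fun w => cons w.head (cons w.tail.head (cons
    (flatMap (fun u => cons (lookup (fun d => (e d : ℕ)) va vb T u) nil) w.tail.tail.head) nil))
  have hF : PolyTime fun O w => ofBool (O (F w)).nonpos :=
    (PolyTime.id.head.cons (PolyTime.id.tail.head.cons ((PolyTime.flatMap
      (F := fun _ _ u => cons (lookup (fun d => (e d : ℕ)) va vb T u) nil)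
      ((PolyTime.id.tail.lookup _ _ _ _).cons (PolyTime.const _)) PolyTime.id.tail.tail.head).cons
        (PolyTime.const _)))).query_nonpos
  obtain ⟨P, p, hP⟩ := hF
  refine ⟨P, p, ?_⟩
  rintro O hO ⟨J, hJ⟩ w ⟨l, hl, rfl⟩
  obtain ⟨t, ht, ht'⟩ := hP O (ofList [unary J.numVars, unary (Fintype.card D), l])
  refine ⟨_, t, ht, ?_, (Nat.le_add_right _ _).trans ht'⟩
  let I : TVCSPInstance D :=
    { numVars := J.numVars
      constraints := ⋃ c ∈ J.constraints, {c.toTV ρ α}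
      finite_constraints := J.finite_constraints.biUnion fun _ _ => Set.finite_singleton _ }
  have hI : ∀ c ∈ I.constraints, ⟨c.arity, c.ρ⟩ ∈ 𝒟 := by
    intro c hc
    obtain ⟨c', hc', rfl⟩ := Set.mem_iUnion₂.1 hc
    exact hρ _ (hJ c' hc')
  have hcode : (TVCSP e 𝒟).Code ⟨I, hI⟩
      (F (ofList [unary J.numVars, unary (Fintype.card D), l])) := by
    refine ⟨_, ?_, rfl⟩
    refine hl.flatMap ?_
    rintro c hc _ ⟨b, hb, rfl⟩
    refine codesSet_singleton ⟨ofList [cons (codeTuple Fin.val c.scope) (va ⟨c.arity, c.rel⟩)],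
      vb ⟨c.arity, c.rel⟩, ?_, hvb _ (hJ c hc), ?_⟩
    -- The chosen level is below `⊤`, so exactly one pair of `σ` has to be listed.
    · have : {x | (c.toTV ρ α).σ x < ⊤} = {c.scope} := by
        refine Set.ext fun x => ⟨fun hx => ?_, ?_⟩
        · by_contra hx'
          exact (Set.mem_ofPred.1 hx).ne (c.toTV_σ_of_ne ρ α hx')
        · rintro rfl
          exact (c.toTV_σ_scope ρ α).trans_lt (hα' _ (hJ c hc))
      rw [CodesValuedRel, this]
      exact codesSet_singleton ⟨_, (c.toTV_σ_scope ρ α).symm ▸ hva _ (hJ c hc), rfl⟩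
    · exact lookup_eq he (r := ⟨c.arity, c.rel⟩) (by simpa [T] using hJ c hc) hb
  have hans : CodesExtRat I.opt _ := hO _ _ hcode
  classical
  refine congrArg ofBool (Bool.eq_iff_iff.2 (Iff.trans ?_ decide_eq_true_iff.symm))
  -- Since `0 < ⊤`, the optimum is at most `0` iff a single assignment has value at most `0`; such
  -- assignments are shown to be the solutions of `J`.
  rw [hans.nonpos_iff, I.opt_le_iff EReal.zero_lt_top]
  refine exists_congr fun s => ?_
  rw [I.value_le_iff]
  have key : ∀ c ∈ J.constraints, (c.toTV ρ α).ρ (s ∘ c.scope) - (c.toTV ρ α).σ c.scope ≤ 0 ↔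
      s ∘ c.scope ∈ c.rel := fun c hc => by
    rw [c.toTV_σ_scope ρ α, EReal_sub_le_iff (hα' _ (hJ c hc)) EReal.zero_lt_top, zero_add]
    exact (Set.ext_iff.1 (hr ⟨c.arity, c.rel⟩ (hJ c hc)) _).symm
  constructor
  · exact fun h c hc => (key c hc).1 (h (c.toTV ρ α) (Set.mem_biUnion hc rfl) c.scope)
  · intro h c hc x
    obtain ⟨c, hc', rfl⟩ := Set.mem_iUnion₂.1 hc
    by_cases hx : x = c.scope
    · rw [hx]
      exact (key c hc').2 (h c hc')
    -- Off the scope `σ = ⊤`, so the difference is `⊥` and imposes nothing.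
    · rw [c.toTV_σ_of_ne ρ α hx]
      simp

/-! ### Reduction of the tropical valued CSP to the CSP -/

/-- `g` represents the threshold `γ`, which is `-∞` or rational. -/
def IsLevel (g : Data) (γ : EReal) : Prop :=
  g = nil ∧ γ = ⊥ ∨ ∃ r : ℝ, IsFrac g r ∧ γ = r

theorem IsFrac.truthy {f : Data} {r : ℝ} (h : IsFrac f r) : f.truthy = true := by
  obtain ⟨P, N, q, -, rfl, -⟩ := h
  rfl

theorem IsLevel.lt_top {g : Data} {γ : EReal} (h : IsLevel g γ) : γ < ⊤ := by
  rcases h with ⟨-, rfl⟩ | ⟨r, -, rfl⟩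
  · exact bot_lt_top
  · exact EReal.coe_lt_top r

theorem CodesExtRat.isFrac {a : ℝ} {v : Data} (h : CodesExtRat (a : EReal) v) :
    v.truthy = true ∧ IsFrac (toFrac v) a := by
  generalize hb : (a : EReal) = b at h
  cases h with
  | bot => simp at hb
  | top => simp at hb
  | rat p q hq =>
    rw [EReal.coe_eq_coe_iff.1 hb]
    exact ⟨rfl, isFrac_toFrac p q hq⟩

theorem CodesExtRat.exists_isFrac {a : EReal} {v : Data} (h : CodesExtRat a v) (ha : a < ⊤)
    (hv : v.truthy = true) : ∃ r, IsFrac (toFrac v) r := by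
  cases h with
  | bot => simp at hv
  | top => simp at ha
  | rat p q hq => exact ⟨_, isFrac_toFrac p q hq⟩

namespace Data

/-- Whether `a - b` is at most the threshold represented by `g`, where `v` and `s` represent
`a < ∞` and `b < ∞`. -/
def levelTest (g v s : Data) : Bool :=
  !v.truthy || (s.truthy && (g.truthy && fracLE (diff (toFrac v) (toFrac s)) g))

/-- The CSP instance that expresses that the optimal value of `w` is at most `g`. -/
def levelInstance (g w : Data) : Data :=
  cons w.head (cons w.tail.head (cons (flatMap (fun c => flatMap (fun x =>
    cons (cons c.head (cons x.head (cons (flatMap (fun d =>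
      cond (levelTest g d.tail x.tail) (cons d.head nil) nil) c.tail.tail.head) nil))) nil)
    c.tail.head) w.tail.tail.head) nil))

/-- The rational numbers that may be the optimal value of `w`. -/
def candidates (w : Data) : Data :=
  flatMap (fun c => flatMap (fun x => flatMap (fun d => cond (d.tail.truthy && x.tail.truthy)
    (cons (diff (toFrac d.tail) (toFrac x.tail)) nil) nil) c.tail.tail.head) c.tail.head)
    w.tail.tail.head

/-- One step of the search for the least fraction that passes the test `β`. -/
def minStep (β : Data → Bool) (best g : Data) : Data :=
  cond (β g && (!best.truthy || fracLE g best)) g best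

/-- The least candidate that passes the test `β`, or `nil`. -/
def leastCandidate (β : Data → Bool) (w : Data) : Data :=
  (candidates w).toList.foldl (minStep β) nil

/-- The optimal value of `w`, found with the test `β` of the thresholds. -/
def optimum (β : Data → Bool) (w : Data) : Data :=
  cond (β nil) nil (cond (leastCandidate β w).truthy (ofFrac (leastCandidate β w)) (cons nil nil))

end Data

/-! ### Running time of the reduction to the CSP. -/

namespace PolyTime

variable {f g h : (Data → Data) → Data → Data}

theorem levelTest (hf : PolyTime f) (hg : PolyTime g) (hh : PolyTime h) :
    PolyTime fun O x => ofBool (levelTest (f O x) (g O x) (h O x)) :=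
  hg.truthy.not.or (hh.truthy.and (hf.truthy.and ((hg.toFrac.diff hh.toFrac).fracLE hf)))

theorem levelInstance (hf : PolyTime f) (hg : PolyTime g) :
    PolyTime fun O x => levelInstance (f O x) (g O x) := by
  refine hg.head.cons (hg.tail.head.cons (cons (flatMap (F := fun O y c => Data.flatMap (fun x =>
    Data.cons (Data.cons c.head (Data.cons x.head (Data.cons (Data.flatMap (fun d =>
      cond (Data.levelTest (f O y) d.tail x.tail) (Data.cons d.head nil) nil) c.tail.tail.head)
      nil))) nil) c.tail.head) ?_ hg.tail.tail.head) (const nil)))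
  refine flatMap (F := fun O p x => Data.cons (Data.cons p.tail.head (Data.cons x.head
    (Data.cons (Data.flatMap (fun d => cond (Data.levelTest (f O p.head) d.tail x.tail)
      (Data.cons d.head nil) nil) p.tail.tail.tail.head) nil))) nil) ?_ id.tail.tail.head
  refine cons (id.head.tail.head.cons (id.tail.head.cons (cons (flatMap (F := fun O p d =>
    cond (Data.levelTest (f O p.head.head) d.tail p.tail.tail) (Data.cons d.head nil) nil) ?_
      id.head.tail.tail.tail.head) (const nil)))) (const nil)
  exact (levelTest (hf.comp id.head.head.head) id.tail.tail id.head.tail.tail).ite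
    (id.tail.head.cons (const nil)) (const nil)

theorem candidates (hf : PolyTime f) : PolyTime fun O x => candidates (f O x) := by
  refine flatMap (F := fun _ _ c => Data.flatMap (fun x => Data.flatMap (fun d =>
    cond (d.tail.truthy && x.tail.truthy)
      (Data.cons (Data.diff (Data.toFrac d.tail) (Data.toFrac x.tail)) nil) nil)
      c.tail.tail.head) c.tail.head) ?_ hf.tail.tail.head
  refine flatMap (F := fun _ p x => Data.flatMap (fun d => cond (d.tail.truthy && x.tail.truthy)
      (Data.cons (Data.diff (Data.toFrac d.tail) (Data.toFrac x.tail)) nil) nil)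
      p.tail.tail.tail.head) ?_ id.tail.tail.head
  refine flatMap (F := fun _ p d => cond (d.tail.truthy && p.tail.tail.truthy)
      (Data.cons (Data.diff (Data.toFrac d.tail) (Data.toFrac p.tail.tail)) nil) nil) ?_
      id.head.tail.tail.tail.head
  exact (id.tail.tail.truthy.and id.head.tail.tail.truthy).ite
    ((id.tail.tail.toFrac.diff id.head.tail.tail.toFrac).cons (const nil)) (const nil)

theorem leastCandidate {β : (Data → Data) → Data → Data → Bool}
    (hβ : PolyTime fun O p => ofBool (β O p.head p.tail)) :
    PolyTime fun O w => leastCandidate (β O w) w := by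
  refine foldl_of_size_le (step := fun O w acc a => minStep (β O w) acc a)
    (((hβ.comp (id.head.cons id.tail.tail)).and (id.tail.head.truthy.not.or
      (id.tail.tail.fracLE id.tail.head))).ite id.tail.tail id.tail.head)
    id.candidates (const nil) id.candidates.exists_size_le.choose fun O w acc a ha => ?_
  have h₁ := id.candidates.exists_size_le.choose_spec O w
  have h₂ := size_le_of_mem ha
  rw [minStep]
  cases β O w a && (!acc.truthy || Data.fracLE a acc)
  · simp
  · simp only [cond_true]
    omega

theorem optimum {β : (Data → Data) → Data → Data → Bool}
    (hβ : PolyTime fun O p => ofBool (β O p.head p.tail)) :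
    PolyTime fun O w => optimum (β O w) w := by
  have h := leastCandidate hβ
  have h₀ : PolyTime fun O w => ofBool (β O w nil) := hβ.comp (id.cons (const nil))
  exact h₀.ite (const nil) (h.truthy.ite h.ofFrac (const _))

end PolyTime

/-- For `a = ⊥` the difference is `⊥` and always passes; for real `a` and `b = ⊥` it is `⊤` and
never passes, as `γ < ⊤`. For real `a` and `b` the threshold `⊥` fails and a rational threshold is
compared as a fraction. -/
theorem levelTest_iff {g v s : Data} {γ a b : EReal} (hg : IsLevel g γ) (hv : CodesExtRat a v)
    (hs : CodesExtRat b s) (ha : a < ⊤) (hb : b < ⊤) : levelTest g v s = true ↔ a - b ≤ γ := by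
  have hγ := hg.lt_top
  induction a with
  | top => simp at ha
  | bot =>
    cases hv
    simp [levelTest]
  | coe a =>
    obtain ⟨hv, hv'⟩ := hv.isFrac
    induction b with
    | top => simp at hb
    | bot =>
      cases hs
      simpa [levelTest, hv] using hγ.ne
    | coe b =>
      obtain ⟨hs, hs'⟩ := hs.isFrac
      rcases hg with ⟨rfl, rfl⟩ | ⟨r, hr, rfl⟩
      · simp only [levelTest, hv, hs, truthy_nil]
        rw [← EReal.coe_sub, le_bot_iff]
        simp [-EReal.coe_sub]
      · rw [← EReal.coe_sub, EReal.coe_le_coe_iff, ← (hv'.diff hs').fracLE_iff hr]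
        simp [levelTest, hv, hs, hr.truthy]

/-- A fraction is never `nil`, so `nil` can mean that no candidate has passed yet. On fractions
`fracLE` is the order of the represented reals, which is total and transitive, so the running
minimum is correct. -/
theorem leastCandidate_spec (β : Data → Bool) (L : List Data)
    (hL : ∀ g ∈ L, ∃ r, IsFrac g r) :
    L.foldl (minStep β) nil = nil ∧ (∀ g ∈ L, β g = false) ∨
      L.foldl (minStep β) nil ∈ L ∧ β (L.foldl (minStep β) nil) = true ∧
        ∀ g ∈ L, β g = true → fracLE (L.foldl (minStep β) nil) g = true := by
  induction L using List.reverseRecOn with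
  | nil => simp
  | append_singleton L a ih =>
    have ih := ih fun g hg => hL g (by simp [hg])
    obtain ⟨r, hr⟩ := hL a (by simp)
    have hL' : ∀ g ∈ L, ∃ r, IsFrac g r := fun g hg => hL g (by simp [hg])
    rw [List.foldl_append, List.foldl_cons, List.foldl_nil]
    generalize L.foldl (minStep β) nil = best at ih
    have haa : fracLE a a = true := (hr.fracLE_iff hr).2 le_rfl
    rcases ih with ⟨rfl, ih⟩ | ⟨hb, hb', ih⟩
    · cases ha : β a
      · left
        simp only [minStep, ha, Bool.false_and, cond_false, List.mem_append, List.mem_singleton]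
        exact ⟨trivial, by rintro g (hg | rfl); exacts [ih g hg, ha]⟩
      · right
        simp only [minStep, ha, truthy_nil, Bool.not_false, Bool.true_or, Bool.and_true, cond_true,
          List.mem_append, List.mem_singleton]
        refine ⟨Or.inr trivial, trivial, ?_⟩
        rintro g (hg | rfl) hg'
        · simp [ih g hg] at hg'
        · exact haa
    · right
      obtain ⟨r', hr'⟩ := hL' best hb
      simp only [minStep, hr'.truthy, Bool.not_true, Bool.false_or, List.mem_append,
        List.mem_singleton]
      cases ha : β a
      · simp only [Bool.false_and, cond_false]
        refine ⟨Or.inl hb, hb', ?_⟩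
        rintro g (hg | rfl) hg'
        · exact ih g hg hg'
        · simp [ha] at hg'
      · cases hab : fracLE a best
        · simp only [Bool.and_false, cond_false]
          refine ⟨Or.inl hb, hb', ?_⟩
          rintro g (hg | rfl) hg'
          · exact ih g hg hg'
          · rw [← Bool.not_eq_true, hr.fracLE_iff hr'] at hab
            exact (hr'.fracLE_iff hr).2 (le_of_not_ge hab)
        · simp only [Bool.and_true, cond_true]
          refine ⟨Or.inr trivial, ha, ?_⟩
          rintro g (hg | rfl) hg'
          · obtain ⟨r'', hr''⟩ := hL' g hg
            exact (hr.fracLE_iff hr'').2 (((hr.fracLE_iff hr').1 hab).trans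
              ((hr'.fracLE_iff hr'').1 (ih g hg hg')))
          · exact haa

/-! ### Threshold instances and the candidates for the optimum. -/

namespace TVCSPInstance

variable {D : Type*} (I : TVCSPInstance D)

/-- A finite nonempty set contains its supremum; an empty set has the excluded supremum `⊥`. -/
theorem exists_eq_value {s : Fin I.numVars → D} (hs : I.value s ≠ ⊥) :
    ∃ c ∈ I.constraints, ∃ x, c.ρ (s ∘ x) - c.σ x = I.value s := by
  let S : Set EReal := ⋃ c ∈ I.constraints, Set.range fun x => c.ρ (s ∘ x) - c.σ x
  have hS : I.value s = sSup S := by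
    refine eq_of_forall_ge_iff fun γ => ?_
    rw [value_le_iff, sSup_le_iff]
    simp only [S, Set.mem_iUnion₂]
    constructor
    · rintro h _ ⟨c, hc, x, rfl⟩
      exact h c hc x
    · exact fun h c hc x => h _ ⟨c, hc, x, rfl⟩
  have hfin : S.Finite := I.finite_constraints.biUnion fun _ _ => Set.finite_range _
  have hne : S.Nonempty := by
    rw [Set.nonempty_iff_ne_empty]
    intro h
    rw [hS, h, sSup_empty] at hs
    exact hs rfl
  obtain ⟨c, hc, x, hx⟩ := Set.mem_iUnion₂.1 (hS ▸ hne.csSup_mem hfin)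
  exact ⟨c, hc, x, hx⟩

/-- The CSP instance whose solutions are the assignments of value at most `γ`. -/
def level (γ : EReal) : CSPInstance D where
  numVars := I.numVars
  constraints := ⋃ c ∈ I.constraints, ⋃ x ∈ {x | c.σ x < ⊤},
    {⟨c.arity, x, {d | c.ρ d - c.σ x ≤ γ}⟩}
  finite_constraints := by
    refine I.finite_constraints.biUnion fun c _ => ?_
    exact Set.Finite.biUnion (Set.toFinite {x | c.σ x < ⊤}) fun _ _ => Set.finite_singleton _

theorem mem_level_solutions {γ : EReal} (s : Fin I.numVars → D) :
    s ∈ (I.level γ).solutions ↔ I.value s ≤ γ := by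
  rw [value_le_iff]
  constructor
  · intro h c hc x
    rcases eq_or_ne (c.σ x) ⊤ with hx | hx
    · simp [hx]
    · exact h ⟨c.arity, x, {d | c.ρ d - c.σ x ≤ γ}⟩
        (Set.mem_biUnion hc (Set.mem_biUnion (lt_top_iff_ne_top.2 hx) rfl))
  · intro h c' hc'
    obtain ⟨c, hc, hc'⟩ := Set.mem_iUnion₂.1 hc'
    obtain ⟨x, hx, rfl⟩ := Set.mem_iUnion₂.1 hc'
    exact h c hc x

/-- The relation imposed at `x` is the sublevel set of `c.ρ` at `γ + c.σ x`, and this level is below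
`⊤` because both summands are. -/
theorem level_mem_U {𝒟 : Set (Σ k : ℕ, ((Fin k → D) → EReal))}
    (hI : ∀ c ∈ I.constraints, ⟨c.arity, c.ρ⟩ ∈ 𝒟) {γ : EReal} (hγ : γ < ⊤) :
    ∀ c ∈ (I.level γ).constraints, ⟨c.arity, c.rel⟩ ∈ U 𝒟 := by
  intro c' hc'
  obtain ⟨c, hc, hc'⟩ := Set.mem_iUnion₂.1 hc'
  obtain ⟨x, hx, rfl⟩ := Set.mem_iUnion₂.1 hc'
  refine ⟨_, hI c hc, γ + c.σ x, EReal.add_lt_top hγ.ne (ne_of_lt hx), ?_⟩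
  exact congrArg (Sigma.mk c.arity) (Set.ext fun d => EReal_sub_le_iff hx hγ)

theorem codes_level {m : ℕ} {e : D ≃ Fin m} {w : Data} (hw : I.Codes e w) {g : Data} {γ : EReal}
    (hg : IsLevel g γ) : (I.level γ).Codes e (levelInstance g w) := by
  obtain ⟨l, hl, rfl⟩ := hw
  refine ⟨_, ?_, rfl⟩
  refine hl.flatMap ?_
  rintro c hc _ ⟨a, b, ha, hb, rfl⟩
  refine ha.flatMap ?_
  rintro x hx _ ⟨s, hs, rfl⟩
  refine codesSet_singleton ⟨_, ?_, rfl⟩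
  -- The code of `c.ρ` lists only tuples of value below `⊤`. None is missed: `c.σ x < ⊤` and `γ < ⊤`
  -- force `c.ρ d < ⊤`. Writing the relation as a union of sets with at most one element matches the
  -- filtering by `flatMap`.
  have : {d | c.ρ d - c.σ x ≤ γ} =
      ⋃ d ∈ {d | c.ρ d < ⊤}, {d' | d' = d ∧ c.ρ d - c.σ x ≤ γ} := by
    ext d
    simp only [Set.mem_iUnion₂]
    refine ⟨fun h => ⟨d, ?_, rfl, h⟩, ?_⟩
    · have h := (EReal_sub_le_iff hx hg.lt_top).1 h
      exact h.trans_lt (EReal.add_lt_top hg.lt_top.ne (ne_of_lt hx))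
    · rintro ⟨d', -, rfl, h⟩
      exact h
  rw [CodesRel, this]
  refine hb.flatMap ?_
  rintro d hd _ ⟨v, hv, rfl⟩
  have key := levelTest_iff hg hv hs hd hx
  simp only [tail_cons, head_cons]
  by_cases h : c.ρ d - c.σ x ≤ γ
  · rw [key.2 h]
    simp only [h, and_true, cond_true]
    exact codesSet_singleton rfl
  · rw [← key, Bool.not_eq_true] at h
    have h' := h
    rw [← Bool.not_eq_true, key] at h'
    rw [h]
    simp only [h', and_false, cond_false]
    exact codesSet_empty

theorem exists_isFrac_of_mem_candidates {m : ℕ} {e : D ≃ Fin m} {w : Data} (hw : I.Codes e w)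
    {g : Data} (hg : g ∈ (candidates w).toList) : ∃ r, IsFrac g r := by
  obtain ⟨l, hl, rfl⟩ := hw
  obtain ⟨u, hu, hg⟩ := mem_flatMap.1 hg
  obtain ⟨c, -, a, b, ha, hb, rfl⟩ := hl.of_mem hu
  obtain ⟨u, hu, hg⟩ := mem_flatMap.1 hg
  obtain ⟨x, hx, s, hs, rfl⟩ := ha.of_mem hu
  obtain ⟨u, hu, hg⟩ := mem_flatMap.1 hg
  obtain ⟨d, hd, v, hv, rfl⟩ := hb.of_mem hu
  simp only [tail_cons] at hg
  cases h : v.truthy && s.truthy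
  · simp [h] at hg
  · obtain ⟨h₁, h₂⟩ := Bool.and_eq_true_iff.1 h
    obtain ⟨r, hr⟩ := hv.exists_isFrac hd h₁
    obtain ⟨r', hr'⟩ := hs.exists_isFrac hx h₂
    have : g = diff (toFrac v) (toFrac s) := by simpa [h] using hg
    exact ⟨r - r', this ▸ hr.diff hr'⟩

/-- A real optimum is attained by an assignment, and the value of that assignment by a single
difference `ρ(s(x)) - σ(x)`. A difference in `EReal` is real only if both terms are, so both are
listed as rational numbers. -/
theorem exists_mem_candidates [Finite D] {m : ℕ} {e : D ≃ Fin m} {w : Data} (hw : I.Codes e w)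
    {r : ℝ} (hr : I.opt = r) : ∃ g ∈ (candidates w).toList, IsFrac g r := by
  obtain ⟨s, hs⟩ := I.opt_eq_top_or.resolve_left (by simp [hr])
  rw [hr] at hs
  obtain ⟨c, hc, x, hx⟩ := I.exists_eq_value (s := s) (by simp [hs])
  rw [hs] at hx
  obtain ⟨l, hl, rfl⟩ := hw
  obtain ⟨_, hu, a, b, ha, hb, rfl⟩ := hl.exists_mem hc
  generalize hρ : c.ρ (s ∘ x) = ρ at hx
  generalize hσ : c.σ x = σ at hx
  induction σ with
  | bot => induction ρ <;> simp at hx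
  | top => simp at hx
  | coe σ =>
    induction ρ with
    | bot => simp at hx
    | top => simp at hx
    | coe ρ =>
      rw [← EReal.coe_sub, EReal.coe_eq_coe_iff] at hx
      obtain ⟨_, hu', σ', hσ', rfl⟩ := ha.exists_mem (a := x) (by simp [hσ])
      obtain ⟨_, hu'', ρ', hρ', rfl⟩ := hb.exists_mem (a := s ∘ x) (by simp [hρ])
      rw [hσ] at hσ'
      rw [hρ] at hρ'
      refine ⟨diff (toFrac ρ') (toFrac σ'), ?_, hx ▸ hρ'.isFrac.2.diff hσ'.isFrac.2⟩
      refine mem_flatMap.2 ⟨_, hu, mem_flatMap.2 ⟨_, hu', mem_flatMap.2 ⟨_, hu'', ?_⟩⟩⟩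
      simp [hρ'.isFrac.1, hσ'.isFrac.1]

/-- A real optimum is itself a candidate and passes its own test, while every passing candidate is
an upper bound of it; hence the least passing candidate equals the optimum. Once `⊥` has been
excluded, no passing candidate means `⊤`. -/
theorem codesExtRat_optimum [Finite D] {m : ℕ} {e : D ≃ Fin m} {w : Data} (hw : I.Codes e w)
    {β : Data → Bool} (hβ : ∀ g γ, IsLevel g γ → (β g = true ↔ I.opt ≤ γ)) :
    CodesExtRat I.opt (optimum β w) := by
  have hbot := hβ nil ⊥ (Or.inl ⟨rfl, rfl⟩)
  have hfrac : ∀ g (r : ℝ), IsFrac g r → (β g = true ↔ I.opt ≤ r) := fun g r hg =>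
    hβ g r (Or.inr ⟨r, hg, rfl⟩)
  rw [optimum]
  cases h : β nil
  · rw [h, le_bot_iff] at hbot
    have hne : I.opt ≠ ⊥ := by simpa using hbot
    rcases leastCandidate_spec β _ fun g hg => I.exists_isFrac_of_mem_candidates hw hg with
      ⟨h₁, h₂⟩ | ⟨h₁, h₂, h₃⟩
    · have : leastCandidate β w = nil := h₁
      rw [this]
      rcases eq_or_ne I.opt ⊤ with htop | htop
      · rw [htop]
        exact CodesExtRat.top
      · obtain ⟨g, hg, hg'⟩ := I.exists_mem_candidates hw (EReal.coe_toReal htop hne).symm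
        have := (hfrac g _ hg').2 (EReal.coe_toReal htop hne).ge
        simp [h₂ g hg] at this
    · obtain ⟨r, hr⟩ := I.exists_isFrac_of_mem_candidates hw h₁
      have hle := (hfrac _ r hr).1 h₂
      have htop : I.opt ≠ ⊤ := (hle.trans_lt (EReal.coe_lt_top r)).ne
      obtain ⟨g, hg, hg'⟩ := I.exists_mem_candidates hw (EReal.coe_toReal htop hne).symm
      -- The optimum passes its own test, so the least passing candidate does not exceed it.
      have := (hr.fracLE_iff hg').1 (h₃ g hg ((hfrac g _ hg').2 (EReal.coe_toReal htop hne).ge))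
      have heq : I.opt = r := by
        refine le_antisymm hle ?_
        rw [← EReal.coe_toReal htop hne]
        exact EReal.coe_le_coe_iff.2 this
      rw [heq, leastCandidate, hr.truthy]
      exact hr.codesExtRat
  · rw [le_bot_iff.1 (hbot.1 h)]
    exact CodesExtRat.bot

end TVCSPInstance

/-- The test of a threshold is one oracle query on its CSP instance; it decides `𝒪(I) ≤ γ`, which is
what the search among the candidates requires. -/
theorem polyTimeReducible_TVCSP_CSP {D : Type*} [Finite D] {m : ℕ} (e : D ≃ Fin m)
    (𝒟 : Set (Σ k : ℕ, ((Fin k → D) → EReal))) :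
    PolyTimeReducible (TVCSP e 𝒟) (CSP e (U 𝒟)) := by
  obtain ⟨P, p, hP⟩ := PolyTime.optimum (β := fun O w g => (O (levelInstance g w)).truthy)
    (PolyTime.id.tail.levelInstance PolyTime.id.head).query_truthy
  classical
  refine ⟨P, p, ?_⟩
  rintro O hO ⟨I, hI⟩ w hw
  obtain ⟨t, ht, ht'⟩ := hP O w
  refine ⟨_, t, ht, ?_, (Nat.le_add_right _ _).trans ht'⟩
  refine I.codesExtRat_optimum hw fun g γ hg => ?_
  have hans : O (levelInstance g w) = ofBool _ :=
    hO ⟨I.level γ, I.level_mem_U hI hg.lt_top⟩ _ (I.codes_level hw hg)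
  rw [hans, truthy_ofBool, decide_eq_true_iff, I.opt_le_iff hg.lt_top]
  exact exists_congr I.mem_level_solutions

end TropicalCSP

open TropicalCSP in
theorem mainTheorem2 {D : Type*} [Fintype D] (e : D ≃ Fin (Fintype.card D))
    (𝒟 : Set (Σ k : ℕ, ((Fin k → D) → EReal))) (h𝒟 : 𝒟.Finite)
    (hrat : ∀ ρ ∈ 𝒟, ∀ d : Fin ρ.1 → D, IsExtRat (ρ.2 d)) :
    PolyTimeReducible (TVCSP e 𝒟) (CSP e (U 𝒟)) ∧
      PolyTimeReducible (CSP e (U 𝒟)) (TVCSP e 𝒟) :=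
  ⟨polyTimeReducible_TVCSP_CSP e 𝒟, polyTimeReducible_CSP_TVCSP e 𝒟 h𝒟 hrat⟩
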